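/- Let $p>1$ and $h\in(0,1)$, and let $a_h:[0,1]\to[0,\infty)$ be the weight with $a_h(x)=0$ for $x\in\left(\frac{1-h}{2},\frac{1+h}{2}\right)$ and $a_h(x)=1$ for all other $x\in[0,1]$. For $\lambda\in\mathbb{R}$ consider the problem $$-u''=\lambda u+a_h(x)u^p\ \text{ in } (0,1),\qquad u(0)=u(1)=0. \tag{1}$$ A positive solution of (1) is a function $u\in C^1([0,1])$ with $u\ge 0$ on $[0,1]$ and $u\not\equiv 0$, with $u'$ absolutely continuous on $[0,1]$, which satisfies the differential equation almost everywhere in $(0,1)$ and the boundary conditions. It is symmetric if $u(1-x)=u(x)$ for all $x\in[0,1]$. Then: 1. For every $\lambda\in(-\infty,\pi^2)$, problem (1) has exactly one symmetric positive solution. 2. For every $\lambda\in\mathbb{R}$, problem (1) has a positive solution if and only if $\lambda<\pi^2$. -/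

import Mathlib

namespace MooreNehari

/-- The weight `a_h` on `[0,1]`: it is `0` on the open interval `((1-h)/2, (1+h)/2)`
and `1` on the rest of `[0,1]` (values outside `[0,1]` are never used). -/
noncomputable def weight (h x : ℝ) : ℝ :=
  open Classical in if x ∈ Set.Ioo ((1 - h) / 2) ((1 + h) / 2) then 0 else 1

/-- `u` solves `-u'' = lam * u + a(x) * u ^ p` in `(0,1)`, `u(0) = u(1) = 0`, in the usual
(strong) sense for a discontinuous weight: `u` is of class `C¹` on `[0,1]` (one-sided derivatives
at the ends), its derivative `v` is absolutely continuous on `[0,1]`, and the differential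
equation, as `-v' = lam * u + a(x) * u ^ p`, holds at almost every point of `(0,1)`.
(The power is the real power; the definition is only used for `u ≥ 0`.) -/
structure IsSolution (a : ℝ → ℝ) (p lam : ℝ) (u : ℝ → ℝ) : Prop where
  equation : ∃ v : ℝ → ℝ,
    (∀ x ∈ Set.Icc (0 : ℝ) 1, HasDerivWithinAt u (v x) (Set.Icc 0 1) x) ∧
    AbsolutelyContinuousOnInterval v 0 1 ∧
    ∀ᵐ x ∂(MeasureTheory.volume.restrict (Set.Ioo (0 : ℝ) 1)),
      HasDerivAt v (-(lam * u x + a x * u x ^ p)) x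
  left_zero : u 0 = 0
  right_zero : u 1 = 0

/-- A positive solution: a solution with `u ≥ 0` on `[0,1]`, not identically zero there. -/
structure IsPositiveSolution (a : ℝ → ℝ) (p lam : ℝ) (u : ℝ → ℝ) : Prop
    extends IsSolution a p lam u where
  nonneg : ∀ x ∈ Set.Icc (0 : ℝ) 1, 0 ≤ u x
  nontrivial : ∃ x ∈ Set.Icc (0 : ℝ) 1, u x ≠ 0

/-- Symmetry (evenness) of a function on `[0,1]` about `x = 1/2`. -/
def IsSymmetric (u : ℝ → ℝ) : Prop :=
  ∀ x ∈ Set.Icc (0 : ℝ) 1, u (1 - x) = u x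

end MooreNehari

open Set MeasureTheory

/-! If `λ ≥ π²`, the Wronskian of `u` with `sin πx` is nonincreasing and vanishes at both ends,
hence is zero; then the equation forces `u = 0` where the weight is `1`, and so everywhere
(`IsPositiveSolution.lt_pi_sq`). If `λ < π²`, the linear equation has an even solution `D` positive
on `[0,1]` (`exists_linear_profile`). Write `u = D w` and `α = D² w' = u' D - u D'`, so that `α' =
-a_h u^p D`. On the middle interval `α` is constant, and symmetry makes it zero at `1/2`. So the
symmetric problem lives on `[0,b]`, `b = (1-h)/2`, with `u 0 = 0` and the Robin condition `α b = 0`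
(`symmetric_data`). Existence is shooting in `A = α 0`: superlinearity gives `α b > 0` for small
`A`, and an a priori bound excludes `α b ≥ 0` for large `A` (`exists_shooting`); the result is
extended by a multiple of `D` and reflected. Uniqueness: if two half-solutions have different
initial slopes, the energy identity and the Robin condition force their graphs to cross in such a
way that the steeper one decreases and later increases, against unimodality
(`not_slope_lt_of_wronskian_eq_zero`). Equal slopes give equal solutions by Grönwall. -/

namespace MooreNehari

/-! ### One-sided calculus on closed intervals. -/

section Calculus

variable {f g f' g' : ℝ → ℝ} {a b x : ℝ}

lemma continuousOn_of_hasDerivWithinAt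
    (hf : ∀ x ∈ Icc a b, HasDerivWithinAt f (f' x) (Icc a b) x) : ContinuousOn f (Icc a b) :=
  fun x hx => (hf x hx).continuousWithinAt

lemma hasDerivWithinAt_Icc_mono {c d : ℝ}
    (hf : ∀ x ∈ Icc a b, HasDerivWithinAt f (f' x) (Icc a b) x) (hac : a ≤ c) (hdb : d ≤ b) :
    ∀ x ∈ Icc c d, HasDerivWithinAt f (f' x) (Icc c d) x :=
  fun x hx => (hf x (Icc_subset_Icc hac hdb hx)).mono (Icc_subset_Icc hac hdb)

lemma hasDerivWithinAt_Ici
    (hf : ∀ x ∈ Icc a b, HasDerivWithinAt f (f' x) (Icc a b) x) :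
    ∀ x ∈ Ico a b, HasDerivWithinAt f (f' x) (Ici x) x :=
  fun x hx => (hf x (Ico_subset_Icc_self hx)).mono_of_mem_nhdsWithin (Icc_mem_nhdsGE_of_mem hx)

lemma monotoneOn_Icc_of_nonneg
    (hf : ∀ x ∈ Icc a b, HasDerivWithinAt f (f' x) (Icc a b) x)
    (h : ∀ x ∈ Ioo a b, 0 ≤ f' x) : MonotoneOn f (Icc a b) := by
  refine monotoneOn_of_hasDerivWithinAt_nonneg (f' := f') (convex_Icc a b)
    (continuousOn_of_hasDerivWithinAt hf) ?_ ?_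
  · rw [interior_Icc]
    exact fun x hx => (hf x (Ioo_subset_Icc_self hx)).mono Ioo_subset_Icc_self
  · rwa [interior_Icc]

lemma antitoneOn_Icc_of_nonpos
    (hf : ∀ x ∈ Icc a b, HasDerivWithinAt f (f' x) (Icc a b) x)
    (h : ∀ x ∈ Ioo a b, f' x ≤ 0) : AntitoneOn f (Icc a b) := by
  have := monotoneOn_Icc_of_nonneg (f := fun x => -f x) (fun x hx => (hf x hx).fun_neg)
    (fun x hx => neg_nonneg.2 (h x hx))
  exact fun x hx y hy hxy => neg_le_neg_iff.1 (this hx hy hxy)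

lemma eq_of_hasDerivWithinAt_zero
    (hf : ∀ x ∈ Icc a b, HasDerivWithinAt f (f' x) (Icc a b) x)
    (h : ∀ x ∈ Icc a b, f' x = 0) {x y : ℝ} (hx : x ∈ Icc a b) (hy : y ∈ Icc a b) :
    f x = f y := by
  have key := constant_of_has_deriv_right_zero (continuousOn_of_hasDerivWithinAt hf)
    (fun x hx => by simpa [h x (Ico_subset_Icc_self hx)] using hasDerivWithinAt_Ici hf x hx)
  rw [key x hx, key y hy]

lemma deriv_eq_zero_of_eqOn_const {c : ℝ} (hab : a < b)
    (hf : ∀ x ∈ Icc a b, HasDerivWithinAt f (f' x) (Icc a b) x)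
    (h : ∀ x ∈ Icc a b, f x = c) (hx : x ∈ Icc a b) : f' x = 0 :=
  (uniqueDiffOn_Icc hab x hx).eq_deriv _ (hf x hx)
    ((hasDerivWithinAt_const x _ c).congr h (h x hx))

/-- The Wronskian of `f` and `g`. -/
lemma hasDerivWithinAt_wronskian {f'' g'' : ℝ} {s : Set ℝ}
    (hf : HasDerivWithinAt f (f' x) s x) (hf' : HasDerivWithinAt f' f'' s x)
    (hg : HasDerivWithinAt g (g' x) s x) (hg' : HasDerivWithinAt g' g'' s x) :
    HasDerivWithinAt (fun x => f' x * g x - f x * g' x) (f'' * g x - f x * g'') s x := by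
  convert! (hf'.fun_mul hg).fun_sub (hf.fun_mul hg') using 1
  ring

end Calculus

/-! ### The linear profile and regularity of solutions. -/

/-- A positive even solution of the linear problem. -/
lemma exists_linear_profile {lam : ℝ} (h : lam < Real.pi ^ 2) :
    ∃ D D' : ℝ → ℝ, (∀ x, HasDerivAt D (D' x) x) ∧ (∀ x, HasDerivAt D' (-(lam * D x)) x) ∧
      (∀ x, D (1 - x) = D x) ∧ (∀ x, D' (1 - x) = -D' x) ∧ ∀ x ∈ Icc (0 : ℝ) 1, 0 < D x := by
  have lin (k x : ℝ) : HasDerivAt (fun x => k * (x - 1 / 2)) k x := by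
    simpa only [mul_one, id] using ((hasDerivAt_id x).sub_const (1 / 2)).const_mul k
  rcases lt_or_ge lam 0 with hl | hl
  · set k := √(-lam)
    have hk : k * k = -lam := Real.mul_self_sqrt (by linarith)
    refine ⟨fun x => Real.cosh (k * (x - 1 / 2)), fun x => k * Real.sinh (k * (x - 1 / 2)),
      fun x => ?_, fun x => ?_, fun x => ?_, fun x => ?_, fun x _ => Real.cosh_pos _⟩
    · simpa [mul_comm] using (lin k x).cosh
    · convert! ((lin k x).sinh).const_mul k using 1
      linear_combination (-Real.cosh (k * (x - 1 / 2))) * hk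
    · simp only []
      rw [show k * (1 - x - 1 / 2) = -(k * (x - 1 / 2)) by ring, Real.cosh_neg]
    · simp only []
      rw [show k * (1 - x - 1 / 2) = -(k * (x - 1 / 2)) by ring, Real.sinh_neg]
      ring
  · set k := √lam
    have hk : k * k = lam := Real.mul_self_sqrt hl
    have hk0 : 0 ≤ k := Real.sqrt_nonneg _
    have hkpi : k < Real.pi := by
      rw [Real.sqrt_lt' Real.pi_pos]
      exact h
    refine ⟨fun x => Real.cos (k * (x - 1 / 2)), fun x => -(k * Real.sin (k * (x - 1 / 2))),
      fun x => ?_, fun x => ?_, fun x => ?_, fun x => ?_, fun x hx => ?_⟩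
    · convert! (lin k x).cos using 1
      ring
    · convert! (((lin k x).sin).const_mul k).fun_neg using 1
      linear_combination (Real.cos (k * (x - 1 / 2))) * hk
    · simp only []
      rw [show k * (1 - x - 1 / 2) = -(k * (x - 1 / 2)) by ring, Real.cos_neg]
    · simp only []
      rw [show k * (1 - x - 1 / 2) = -(k * (x - 1 / 2)) by ring, Real.sin_neg]
      ring
    -- Since `k < π` and `|x - 1/2| ≤ 1/2`, the argument stays inside `(-π/2, π/2)`.
    · refine Real.cos_pos_of_mem_Ioo ⟨?_, ?_⟩ <;> nlinarith [hx.1, hx.2]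

/-- Where the weight is constant, the derivative of a solution is differentiable everywhere and
the equation holds classically. -/
lemma hasDerivWithinAt_of_ae_equation {a u v : ℝ → ℝ} {p lam k c d : ℝ} (hp : 0 ≤ p)
    (hc : 0 ≤ c) (hd : d ≤ 1)
    (hu : ContinuousOn u (Icc 0 1)) (hv : AbsolutelyContinuousOnInterval v 0 1)
    (hae : ∀ᵐ x ∂(volume.restrict (Ioo (0 : ℝ) 1)), HasDerivAt v (-(lam * u x + a x * u x ^ p)) x)
    (ha : ∀ x ∈ Ioo c d, a x = k) :
    ∀ x ∈ Icc c d, HasDerivWithinAt v (-(lam * u x + k * u x ^ p)) (Icc c d) x := by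
  intro x hx
  -- The almost everywhere equation and absolute continuity make `v` an integral of the continuous
  -- `G`; the fundamental theorem then gives a derivative at every point, one-sided at `c` and `d`.
  have hcd : c ≤ d := hx.1.trans hx.2
  set G : ℝ → ℝ := fun x => -(lam * u x + k * u x ^ p)
  have hG : ContinuousOn G (Icc c d) := by
    have hu' := hu.mono (Icc_subset_Icc hc hd)
    exact ((hu'.const_mul lam).add ((hu'.rpow_const fun x _ => Or.inr hp).const_mul k)).neg
  have hint (y : ℝ) (hy : y ∈ Icc c d) : v y = v c + ∫ t in c..y, G t := by
    have hmono := hv.mono (c := c) (d := y) (by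
      rw [uIcc_of_le hy.1, uIcc_of_le zero_le_one]
      exact Icc_subset_Icc hc (hy.2.trans hd))
    have h1 : ∫ t in c..y, deriv v t = ∫ t in c..y, G t := by
      refine intervalIntegral.integral_congr_ae ?_
      rw [ae_restrict_iff' measurableSet_Ioo] at hae
      have hne : ∀ᵐ t : ℝ, t ≠ y := by simp [ae_iff]
      filter_upwards [hae, hne] with t ht hty htm
      rw [uIoc_of_le hy.1] at htm
      have hlt : t < y := lt_of_le_of_ne htm.2 hty
      rw [(ht ⟨hc.trans_lt htm.1, hlt.trans_le (hy.2.trans hd)⟩).deriv,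
        ha t ⟨htm.1, hlt.trans_le hy.2⟩]
    linarith [hmono.integral_deriv_eq_sub]
  have : Fact (x ∈ Icc c d) := ⟨hx⟩
  have key : HasDerivWithinAt (fun y => v c + ∫ t in c..y, G t) (G x) (Icc c d) x := by
    refine HasDerivWithinAt.const_add _ ?_
    refine intervalIntegral.integral_hasDerivWithinAt_right ?_
      (hG.stronglyMeasurableAtFilter_nhdsWithin measurableSet_Icc x) (hG x hx)
    refine (hG.mono ?_).intervalIntegrable
    rw [uIcc_of_le hx.1]
    exact Icc_subset_Icc_right hx.2
  exact key.congr hint (hint x hx)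

lemma weight_eq_one {h x : ℝ} (hx : x ≤ (1 - h) / 2 ∨ (1 + h) / 2 ≤ x) : weight h x = 1 := by
  unfold weight
  rw [if_neg]
  rintro ⟨h1, h2⟩
  rcases hx with hx | hx <;> linarith

lemma weight_eq_zero {h x : ℝ} (hx : x ∈ Ioo ((1 - h) / 2) ((1 + h) / 2)) : weight h x = 0 :=
  if_pos hx

/-- A function with vanishing Wronskian against `g` is proportional to `g`. -/
lemma div_eq_div_of_wronskian_eq_zero {f g f' g' : ℝ → ℝ} {a b x y : ℝ}
    (hf : ∀ x ∈ Icc a b, HasDerivWithinAt f (f' x) (Icc a b) x)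
    (hg : ∀ x ∈ Icc a b, HasDerivWithinAt g (g' x) (Icc a b) x)
    (hg0 : ∀ x ∈ Icc a b, g x ≠ 0)
    (hW : ∀ x ∈ Icc a b, f' x * g x - f x * g' x = 0) (hx : x ∈ Icc a b) (hy : y ∈ Icc a b) :
    f x / g x = f y / g y :=
  eq_of_hasDerivWithinAt_zero (f := fun x => f x / g x)
    (fun x hx => (hf x hx).fun_div (hg x hx) (hg0 x hx)) (fun x hx => by rw [hW x hx, zero_div])
    hx hy

/-- The derivative of a solution, together with the classical equation on the three intervals
where the weight is constant. -/
lemma IsSolution.exists_deriv {p h lam : ℝ} {u : ℝ → ℝ} (hp : 0 ≤ p)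
    (hh : h ∈ Ioo (0 : ℝ) 1) (hu : IsSolution (weight h) p lam u) :
    ∃ v : ℝ → ℝ, (∀ x ∈ Icc (0 : ℝ) 1, HasDerivWithinAt u (v x) (Icc 0 1) x) ∧
      (∀ x ∈ Icc 0 ((1 - h) / 2),
        HasDerivWithinAt v (-(lam * u x + u x ^ p)) (Icc 0 ((1 - h) / 2)) x) ∧
      (∀ x ∈ Icc ((1 - h) / 2) ((1 + h) / 2),
        HasDerivWithinAt v (-(lam * u x)) (Icc ((1 - h) / 2) ((1 + h) / 2)) x) ∧
      (∀ x ∈ Icc ((1 + h) / 2) 1,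
        HasDerivWithinAt v (-(lam * u x + u x ^ p)) (Icc ((1 + h) / 2) 1) x) := by
  obtain ⟨v, huv, hv, hae⟩ := hu.equation
  have hc := continuousOn_of_hasDerivWithinAt huv
  obtain ⟨h0, h1⟩ := hh
  refine ⟨v, huv, ?_, ?_, ?_⟩
  · simpa using hasDerivWithinAt_of_ae_equation (k := 1) (c := 0) (d := (1 - h) / 2) hp le_rfl
      (by linarith) hc hv hae (fun x hx => weight_eq_one (Or.inl hx.2.le))
  · simpa using hasDerivWithinAt_of_ae_equation (k := 0) (c := (1 - h) / 2) (d := (1 + h) / 2) hp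
      (by linarith) (by linarith) hc hv hae (fun x hx => weight_eq_zero hx)
  · simpa using hasDerivWithinAt_of_ae_equation (k := 1) (c := (1 + h) / 2) (d := 1) hp
      (by linarith) le_rfl hc hv hae (fun x hx => weight_eq_one (Or.inr hx.1.le))

/-! ### Necessity of `λ < π²`. -/

lemma IsPositiveSolution.lt_pi_sq {p h lam : ℝ} {u : ℝ → ℝ} (hp : 0 ≤ p)
    (hh : h ∈ Ioo (0 : ℝ) 1) (hu : IsPositiveSolution (weight h) p lam u) :
    lam < Real.pi ^ 2 := by
  by_contra! hlam
  obtain ⟨v, huv, hl, hm, hr⟩ := hu.toIsSolution.exists_deriv hp hh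
  obtain ⟨h0, h1⟩ := hh
  have hpi := Real.pi_pos
  set S : ℝ → ℝ := fun x => Real.sin (Real.pi * x)
  set S' : ℝ → ℝ := fun x => Real.pi * Real.cos (Real.pi * x)
  have lin (x : ℝ) : HasDerivAt (fun x => Real.pi * x) Real.pi x := by
    simpa using (hasDerivAt_id x).const_mul Real.pi
  have hS (x : ℝ) : HasDerivAt S (S' x) x := by
    simpa [S, S', mul_comm] using (lin x).sin
  have hS' (x : ℝ) : HasDerivAt S' (-(Real.pi ^ 2 * S x)) x := by
    convert! (lin x).cos.const_mul Real.pi using 1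
    ring
  have hSpos (x : ℝ) (hx : x ∈ Ioo (0 : ℝ) 1) : 0 < S x :=
    Real.sin_pos_of_pos_of_lt_pi (mul_pos hpi hx.1) (by nlinarith [hx.2])
  have hSnn (x : ℝ) (hx : x ∈ Icc (0 : ℝ) 1) : 0 ≤ S x :=
    Real.sin_nonneg_of_nonneg_of_le_pi (mul_nonneg hpi.le hx.1) (by nlinarith [hx.2])
  set W : ℝ → ℝ := fun x => v x * S x - u x * S' x
  have hW (c d k : ℝ) (hc : 0 ≤ c) (hd : d ≤ 1)
      (hv : ∀ x ∈ Icc c d, HasDerivWithinAt v (-(lam * u x + k * u x ^ p)) (Icc c d) x) :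
      ∀ x ∈ Icc c d,
        HasDerivWithinAt W (-((lam - Real.pi ^ 2) * u x + k * u x ^ p) * S x) (Icc c d) x := by
    intro x hx
    convert! hasDerivWithinAt_wronskian (hasDerivWithinAt_Icc_mono huv hc hd x hx) (hv x hx)
      (hS x).hasDerivWithinAt (hS' x).hasDerivWithinAt using 1
    ring
  have hanti (c d k : ℝ) (hk : 0 ≤ k) (hc : 0 ≤ c) (hd : d ≤ 1)
      (hv : ∀ x ∈ Icc c d, HasDerivWithinAt v (-(lam * u x + k * u x ^ p)) (Icc c d) x) :
      AntitoneOn W (Icc c d) := by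
    refine antitoneOn_Icc_of_nonpos (hW c d k hc hd hv) fun x hx => ?_
    have hx' : x ∈ Icc (0 : ℝ) 1 := ⟨hc.trans hx.1.le, hx.2.le.trans hd⟩
    have hux := hu.nonneg x hx'
    rw [neg_mul]
    have := sub_nonneg.2 hlam
    have := hSnn x hx'
    exact neg_nonpos.2 (by positivity)
  have hl' := hW 0 ((1 - h) / 2) 1 le_rfl (by linarith) (by simpa using hl)
  have al := hanti 0 ((1 - h) / 2) 1 zero_le_one le_rfl (by linarith) (by simpa using hl)
  have am := hanti ((1 - h) / 2) ((1 + h) / 2) 0 le_rfl (by linarith) (by linarith) (by simpa using hm)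
  have ar := hanti ((1 + h) / 2) 1 1 zero_le_one (by linarith) le_rfl (by simpa using hr)
  have W0 : W 0 = 0 := by simp [W, S, hu.left_zero]
  have W1 : W 1 = 0 := by simp [W, S, hu.right_zero]
  have e1 := al (a := 0) (b := (1 - h) / 2) ⟨le_rfl, by linarith⟩ ⟨by linarith, le_rfl⟩
    (by linarith)
  have e2 := am (a := (1 - h) / 2) (b := (1 + h) / 2) ⟨le_rfl, by linarith⟩
    ⟨by linarith, le_rfl⟩ (by linarith)
  have e3 := ar (a := (1 + h) / 2) (b := 1) ⟨le_rfl, by linarith⟩ ⟨by linarith, le_rfl⟩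
    (by linarith)
  have Wz (x : ℝ) (hx : x ∈ Icc (0 : ℝ) 1) : W x = 0 := by
    rcases le_total x ((1 - h) / 2) with hx1 | hx1
    · have := al (a := 0) (b := x) ⟨le_rfl, by linarith⟩ ⟨hx.1, hx1⟩ hx.1
      have := al (a := x) (b := (1 - h) / 2) ⟨hx.1, hx1⟩ ⟨by linarith, le_rfl⟩ hx1
      linarith
    rcases le_total x ((1 + h) / 2) with hx2 | hx2
    · have := am (a := (1 - h) / 2) (b := x) ⟨le_rfl, by linarith⟩ ⟨hx1, hx2⟩ hx1
      have := am (a := x) (b := (1 + h) / 2) ⟨hx1, hx2⟩ ⟨by linarith, le_rfl⟩ hx2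
      linarith
    · have := ar (a := (1 + h) / 2) (b := x) ⟨le_rfl, by linarith⟩ ⟨hx2, hx.2⟩ hx2
      have := ar (a := x) (b := 1) ⟨hx2, hx.2⟩ ⟨by linarith, le_rfl⟩ hx.2
      linarith
  -- The midpoint of the left interval, where the weight is `1`. There `W' = 0` is a sum of
  -- nonnegative terms, and the power term gives `u c = 0` even when `λ = π²`.
  set c := (1 - h) / 4
  have hc : c ∈ Ioo (0 : ℝ) 1 := ⟨by simp only [c]; linarith, by simp only [c]; linarith⟩
  have huc : u c = 0 := by
    have hcm : c ∈ Icc 0 ((1 - h) / 2) := ⟨hc.1.le, by simp only [c]; linarith⟩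
    have h3 := deriv_eq_zero_of_eqOn_const (by linarith) hl'
      (fun x hx => Wz x ⟨hx.1, by linarith [hx.2]⟩) hcm
    have h4 := hSpos c hc
    have h5 := hu.nonneg c (Ioo_subset_Icc_self hc)
    have h6 : (lam - Real.pi ^ 2) * u c + 1 * u c ^ p = 0 := by
      rcases mul_eq_zero.1 h3 with h | h <;> linarith
    have h7 := mul_nonneg (sub_nonneg.2 hlam) h5
    by_contra hne
    have := Real.rpow_pos_of_pos (lt_of_le_of_ne h5 (Ne.symm hne)) p
    linarith
  obtain ⟨x, hx, hux⟩ := hu.nontrivial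
  apply hux
  rcases eq_or_lt_of_le hx.1 with h | hx0
  · rw [← h, hu.left_zero]
  rcases eq_or_lt_of_le hx.2 with h | hx1
  · rw [h, hu.right_zero]
  -- The sine vanishes at `0` and `1`, so `u / S` is compared only on the segment joining `x` to
  -- `c`.
  have hI : Icc (min x c) (max x c) ⊆ Ioo 0 1 := fun y hy =>
    ⟨(lt_min hx0 hc.1).trans_le hy.1, hy.2.trans_lt (max_lt hx1 hc.2)⟩
  have := div_eq_div_of_wronskian_eq_zero (a := min x c) (b := max x c) (x := x) (y := c)
    (fun y hy => (huv y (Ioo_subset_Icc_self (hI hy))).mono (hI.trans Ioo_subset_Icc_self))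
    (fun y _ => (hS y).hasDerivWithinAt) (fun y hy => (hSpos y (hI hy)).ne')
    (fun y hy => Wz y (Ioo_subset_Icc_self (hI hy))) ⟨min_le_left _ _, le_max_left _ _⟩
    ⟨min_le_right _ _, le_max_right _ _⟩
  rw [huc, zero_div, div_eq_zero_iff] at this
  exact this.resolve_right (hSpos x ⟨hx0, hx1⟩).ne'

lemma abs_rpow_sub_rpow_le {p M z y : ℝ} (hp : 1 ≤ p) (hz : z ∈ Icc 0 M) (hy : y ∈ Icc 0 M) :
    |z ^ p - y ^ p| ≤ p * M ^ (p - 1) * |z - y| := by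
  refine Convex.norm_image_sub_le_of_norm_hasDerivWithin_le (f := fun t : ℝ => t ^ p)
    (f' := fun t => p * t ^ (p - 1)) (fun t _ => ?_) (fun t ht => ?_) (convex_Icc 0 M) hy hz
  · exact (Real.hasDerivAt_rpow_const (Or.inr hp)).hasDerivWithinAt
  · rw [Real.norm_of_nonneg (mul_nonneg (by linarith) (Real.rpow_nonneg ht.1 _))]
    exact mul_le_mul_of_nonneg_left (Real.rpow_le_rpow ht.1 ht.2 (by linarith)) (by linarith)

/-! ### Energy, crossing and uniqueness on the initial interval. -/

section InitialInterval

variable {p lam b : ℝ} {u u' y y' : ℝ → ℝ}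

/-- The first integral obtained on multiplying the equation by `2 u'`. -/
lemma energy_eq (hp : 1 < p)
    (hu : ∀ x ∈ Icc 0 b, HasDerivWithinAt u (u' x) (Icc 0 b) x)
    (hu' : ∀ x ∈ Icc 0 b, HasDerivWithinAt u' (-(lam * u x + u x ^ p)) (Icc 0 b) x)
    (u0 : u 0 = 0) {x : ℝ} (hx : x ∈ Icc 0 b) :
    u' x ^ 2 + lam * u x ^ 2 + 2 / (p + 1) * u x ^ (p + 1) = u' 0 ^ 2 := by
  have key : ∀ x ∈ Icc 0 b, HasDerivWithinAt
      (fun x => u' x ^ 2 + lam * u x ^ 2 + 2 / (p + 1) * u x ^ (p + 1)) 0 (Icc 0 b) x := by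
    intro x hx
    convert! (((hu' x hx).fun_pow 2).fun_add (((hu x hx).fun_pow 2).const_mul lam)).fun_add
      (((hu x hx).rpow_const (p := p + 1) (Or.inr (by linarith))).const_mul (2 / (p + 1))) using 1
    rw [add_sub_cancel_right]
    have : p + 1 ≠ 0 := by linarith
    field_simp
    ring
  rw [eq_of_hasDerivWithinAt_zero key (fun _ _ => rfl) hx ⟨le_rfl, hx.1.trans hx.2⟩, u0,
    Real.zero_rpow (by linarith)]
  ring

/-- A positive solution starting with nonzero slope is unimodal. -/
lemma deriv_nonpos_of_deriv_nonpos (hp : 1 < p)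
    (hu : ∀ x ∈ Icc 0 b, HasDerivWithinAt u (u' x) (Icc 0 b) x)
    (hu' : ∀ x ∈ Icc 0 b, HasDerivWithinAt u' (-(lam * u x + u x ^ p)) (Icc 0 b) x)
    (u0 : u 0 = 0) (upos : ∀ x ∈ Ioc 0 b, 0 < u x) (hs : u' 0 ≠ 0)
    {z x : ℝ} (hz : 0 < z) (hzx : z ≤ x) (hxb : x ≤ b) (huz : u' z ≤ 0) : u' x ≤ 0 := by
  have hd := hasDerivWithinAt_Icc_mono hu' hz.le le_rfl
  -- Barrier at zero: where `u' = 0`, the energy gives `λ u + 2/(p+1) u^p > 0`, and `2/(p+1) < 1`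
  -- upgrades this to `u'' < 0`.
  refine image_le_of_deriv_right_lt_deriv_boundary' (B := fun _ => 0) (B' := fun _ => 0)
    (continuousOn_of_hasDerivWithinAt hd) (hasDerivWithinAt_Ici hd) huz continuousOn_const
    (fun _ _ => hasDerivWithinAt_const _ _ _) (fun t ht h0 => ?_) ⟨hzx, hxb⟩
  have htp := upos t ⟨hz.trans_le ht.1, ht.2.le⟩
  have hE := energy_eq hp hu hu' u0 (x := t) ⟨hz.le.trans ht.1, ht.2.le⟩
  have hs2 : 0 < u' 0 ^ 2 := by positivity
  rw [h0, Real.rpow_add_one htp.ne'] at hE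
  have h1 : 0 < u t * (lam * u t + 2 / (p + 1) * u t ^ p) := by nlinarith
  have h2 := pos_of_mul_pos_right h1 htp.le
  have h3 := Real.rpow_pos_of_pos htp p
  have h4 : 2 / (p + 1) < 1 := by
    rw [div_lt_one (by linarith)]
    linarith
  have h5 := mul_lt_mul_of_pos_right h4 h3
  linarith

/-- Two positive solutions on `[0, b]` with proportional data at `b` cannot have different
initial slopes. -/
lemma not_slope_lt_of_wronskian_eq_zero (hp : 1 < p) (hb : 0 < b)
    (hu : ∀ x ∈ Icc 0 b, HasDerivWithinAt u (u' x) (Icc 0 b) x)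
    (hu' : ∀ x ∈ Icc 0 b, HasDerivWithinAt u' (-(lam * u x + u x ^ p)) (Icc 0 b) x)
    (u0 : u 0 = 0) (upos : ∀ x ∈ Ioc 0 b, 0 < u x) (hsu : 0 ≤ u' 0)
    (hy : ∀ x ∈ Icc 0 b, HasDerivWithinAt y (y' x) (Icc 0 b) x)
    (hy' : ∀ x ∈ Icc 0 b, HasDerivWithinAt y' (-(lam * y x + y x ^ p)) (Icc 0 b) x)
    (y0 : y 0 = 0) (ypos : ∀ x ∈ Ioc 0 b, 0 < y x)
    (hR : u' b * y b - u b * y' b = 0) : ¬ u' 0 < y' 0 := by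
  intro hlt
  have Eu (x : ℝ) (hx : x ∈ Icc 0 b) := energy_eq hp hu hu' u0 hx
  have Ey (x : ℝ) (hx : x ∈ Icc 0 b) := energy_eq hp hy hy' y0 hx
  have hE : u' 0 ^ 2 < y' 0 ^ 2 := by nlinarith
  have hbm : b ∈ Icc 0 b := ⟨hb.le, le_rfl⟩
  have hub := upos b ⟨hb, le_rfl⟩
  have hyb := ypos b ⟨hb, le_rfl⟩
  have hp1 : 0 < 2 / (p + 1) := div_pos two_pos (by linarith)
  -- The data of `u` at `b` are `θ` times those of `y`. If `θ ≥ 1`, then `θ^(p+1) ≥ θ²` makes the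
  -- energy of `u` at least `θ²` times that of `y`, but it is strictly smaller.
  have hlt_b : u b < y b := by
    by_contra! hle
    set θ := u b / y b with hθ
    have h1 : u b = θ * y b := by rw [hθ]; field_simp
    have h2 : u' b = θ * y' b := by
      rw [hθ]
      field_simp
      linarith
    have hθ1 : 1 ≤ θ := by rwa [hθ, le_div_iff₀ hyb, one_mul]
    have e1 := Eu b hbm
    have e2 := Ey b hbm
    rw [h1, h2, Real.mul_rpow (by linarith) hyb.le] at e1
    have h3 : θ ^ 2 ≤ θ ^ (p + 1) := by
      rw [← Real.rpow_natCast]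
      exact Real.rpow_le_rpow_of_exponent_le hθ1 (by push_cast; linarith)
    have h4 : 0 ≤ (θ ^ (p + 1) - θ ^ 2) * (2 / (p + 1) * y b ^ (p + 1)) :=
      mul_nonneg (by linarith) (by positivity)
    have h5 : θ ^ 2 * y' 0 ^ 2 ≤ u' 0 ^ 2 := by
      rw [← e1, ← e2]
      nlinarith
    have h6 : 0 ≤ (θ ^ 2 - 1) * y' 0 ^ 2 := mul_nonneg (by nlinarith) (sq_nonneg _)
    linarith
  have hW : ∀ x ∈ Icc 0 b, HasDerivWithinAt (fun x => u' x * y x - u x * y' x)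
      (u x * y x ^ p - u x ^ p * y x) (Icc 0 b) x := by
    intro x hx
    convert! hasDerivWithinAt_wronskian (hu x hx) (hu' x hx) (hy x hx) (hy' x hx) using 1
    ring
  -- If `u ≤ y` throughout, the Wronskian is nondecreasing from `0` to `0`, hence constant; but its
  -- derivative at `b` is positive because `u b < y b`.
  obtain ⟨x₀, hx₀, hx₀'⟩ : ∃ x ∈ Ioo 0 b, y x < u x := by
    by_contra! hle
    have hmul {s t : ℝ} (hs : 0 < s) (ht : 0 < t) :
        s * t ^ p - s ^ p * t = s * t * (t ^ (p - 1) - s ^ (p - 1)) := by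
      rw [Real.rpow_sub_one ht.ne', Real.rpow_sub_one hs.ne']
      field_simp
    have hmono := monotoneOn_Icc_of_nonneg hW (fun x hx => by
      have h1 := upos x (Ioo_subset_Ioc_self hx)
      have h2 := ypos x (Ioo_subset_Ioc_self hx)
      rw [hmul h1 h2]
      exact mul_nonneg (mul_pos h1 h2).le
        (sub_nonneg.2 (Real.rpow_le_rpow h1.le (hle x hx) (by linarith))))
    have h0 : (fun x => u' x * y x - u x * y' x) 0 = 0 := by simp [u0, y0]
    have hz := deriv_eq_zero_of_eqOn_const (c := 0) hb hW (fun x hx => by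
      have h1 := hmono ⟨le_rfl, hb.le⟩ hx hx.1
      have h2 := hmono hx hbm hx.2
      simp only [hR, h0] at h1 h2
      exact le_antisymm h2 h1) hbm
    rw [hmul hub hyb] at hz
    have := mul_pos (mul_pos hub hyb)
      (sub_pos.2 (Real.rpow_lt_rpow hub.le hlt_b (by linarith : 0 < p - 1)))
    linarith
  -- At a crossing the energies differ only through the squared slopes.
  have slope_lt {z : ℝ} (hz : z ∈ Icc 0 b) (h : u z = y z) : u' z ^ 2 < y' z ^ 2 := by
    have e1 := Eu z hz
    have e2 := Ey z hz
    rw [h] at e1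
    linarith
  -- If `y' ≥ 0` before `x₀`, then `u' < y'` at every contact, so `u`, which starts out below `y`,
  -- could never get above it.
  obtain ⟨z₁, hz₁, hz₁'⟩ : ∃ z ∈ Ioo 0 x₀, y' z < 0 := by
    have hd : ∀ x ∈ Icc 0 x₀, HasDerivWithinAt (fun x => u x - y x) (u' x - y' x) (Icc 0 x₀) x :=
      hasDerivWithinAt_Icc_mono (fun x hx => (hu x hx).fun_sub (hy x hx)) le_rfl hx₀.2.le
    by_contra! hnn
    have := image_le_of_deriv_right_lt_deriv_boundary' (B := fun _ => 0) (B' := fun _ => 0)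
      (continuousOn_of_hasDerivWithinAt hd) (hasDerivWithinAt_Ici hd) (by simp [u0, y0])
      continuousOn_const (fun _ _ => hasDerivWithinAt_const _ _ _) (fun t ht h0 => ?_)
      (right_mem_Icc.2 hx₀.1.le)
    · linarith
    · rcases eq_or_lt_of_le ht.1 with h | h
      · rw [← h]
        linarith
      · have h1 := slope_lt (z := t) ⟨ht.1, ht.2.le.trans hx₀.2.le⟩ (by linarith)
        have h2 := hnn t ⟨h, ht.2⟩
        linarith [le_abs_self (u' t), abs_lt_of_sq_lt_sq h1 h2]
  -- Likewise, if `y' ≤ 0` after `x₀`, then `y' < u'` at every contact and `y` could not overtake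
  -- `u` before `b`.
  obtain ⟨z₂, hz₂, hz₂'⟩ : ∃ z ∈ Ico x₀ b, 0 < y' z := by
    have hd : ∀ x ∈ Icc x₀ b, HasDerivWithinAt (fun x => y x - u x) (y' x - u' x) (Icc x₀ b) x :=
      hasDerivWithinAt_Icc_mono (fun x hx => (hy x hx).fun_sub (hu x hx)) hx₀.1.le le_rfl
    by_contra! hnn
    have := image_le_of_deriv_right_lt_deriv_boundary' (B := fun _ => 0) (B' := fun _ => 0)
      (continuousOn_of_hasDerivWithinAt hd) (hasDerivWithinAt_Ici hd) (by linarith)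
      continuousOn_const (fun _ _ => hasDerivWithinAt_const _ _ _) (fun t ht h0 => ?_)
      (right_mem_Icc.2 hx₀.2.le)
    · linarith
    · have h1 := slope_lt (z := t) ⟨hx₀.1.le.trans ht.1, ht.2.le⟩ (by linarith)
      have h2 := hnn t ht
      have h3 := abs_lt_of_sq_lt_sq (a := u' t) (b := -y' t) (by linarith [neg_sq (y' t)])
        (by linarith)
      linarith [neg_abs_le (u' t)]
  have := deriv_nonpos_of_deriv_nonpos hp hy hy' y0 ypos (by linarith) hz₁.1
    (hz₁.2.le.trans hz₂.1) hz₂.2.le hz₁'.le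
  linarith

/-- Both solutions are bounded and `t^p` is Lipschitz on bounded subsets of `[0,∞)`, so Grönwall
applies to the pair of differences `(u - y, u' - y')`. -/
lemma eqOn_of_slope_eq (hp : 1 ≤ p)
    (hu : ∀ x ∈ Icc 0 b, HasDerivWithinAt u (u' x) (Icc 0 b) x)
    (hu' : ∀ x ∈ Icc 0 b, HasDerivWithinAt u' (-(lam * u x + u x ^ p)) (Icc 0 b) x)
    (unn : ∀ x ∈ Icc 0 b, 0 ≤ u x)
    (hy : ∀ x ∈ Icc 0 b, HasDerivWithinAt y (y' x) (Icc 0 b) x)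
    (hy' : ∀ x ∈ Icc 0 b, HasDerivWithinAt y' (-(lam * y x + y x ^ p)) (Icc 0 b) x)
    (ynn : ∀ x ∈ Icc 0 b, 0 ≤ y x) (h0 : u 0 = y 0) (h0' : u' 0 = y' 0) :
    EqOn u y (Icc 0 b) := by
  obtain ⟨M₁, hM₁⟩ := isCompact_Icc.exists_bound_of_continuousOn
    (continuousOn_of_hasDerivWithinAt hu)
  obtain ⟨M₂, hM₂⟩ := isCompact_Icc.exists_bound_of_continuousOn
    (continuousOn_of_hasDerivWithinAt hy)
  set M := max M₁ M₂
  have hd : ∀ x ∈ Icc 0 b, HasDerivWithinAt (fun x => (u x - y x, u' x - y' x))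
      (u' x - y' x, -(lam * u x + u x ^ p) - -(lam * y x + y x ^ p)) (Icc 0 b) x :=
    fun x hx => ((hu x hx).fun_sub (hy x hx)).prodMk ((hu' x hx).fun_sub (hy' x hx))
  have key := eq_zero_of_abs_deriv_le_mul_abs_self_of_eq_zero_right
    (K := 1 + |lam| + p * M ^ (p - 1))
    (fun x hx => (hd x hx).continuousWithinAt)
    (fun x hx => (hd x (Ico_subset_Icc_self hx)).mono_of_mem_nhdsWithin (Icc_mem_nhdsGE_of_mem hx))
    (by simp [h0, h0']) (fun x hx => ?_)
  · intro x hx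
    have := congrArg Prod.fst (key x hx)
    simpa [sub_eq_zero] using this
  · have hxm := Ico_subset_Icc_self hx
    have hM0 : 0 ≤ M := ((norm_nonneg _).trans (hM₁ x hxm)).trans (le_max_left _ _)
    have hL : 0 ≤ p * M ^ (p - 1) := mul_nonneg (by linarith) (Real.rpow_nonneg hM0 _)
    have h1 := abs_rpow_sub_rpow_le (M := M) hp
      ⟨unn x hxm, (le_abs_self _).trans ((hM₁ x hxm).trans (le_max_left _ _))⟩
      ⟨ynn x hxm, (le_abs_self _).trans ((hM₂ x hxm).trans (le_max_right _ _))⟩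
    simp only [Prod.norm_def, Real.norm_eq_abs]
    set m := max |u x - y x| |u' x - y' x|
    have m1 : |u x - y x| ≤ m := le_max_left _ _
    have m2 : |u' x - y' x| ≤ m := le_max_right _ _
    have m0 : 0 ≤ m := (abs_nonneg _).trans m1
    refine max_le ?_ ?_
    · nlinarith [abs_nonneg lam]
    · calc |-(lam * u x + u x ^ p) - -(lam * y x + y x ^ p)|
          = |lam * (u x - y x) + (u x ^ p - y x ^ p)| := by rw [← abs_neg]; congr 1; ring
        _ ≤ |lam * (u x - y x)| + |u x ^ p - y x ^ p| := abs_add_le _ _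
        _ ≤ |lam| * m + p * M ^ (p - 1) * m := by
            rw [abs_mul]
            exact add_le_add (by gcongr) (h1.trans (by gcongr))
        _ ≤ (1 + |lam| + p * M ^ (p - 1)) * m := by linarith

end InitialInterval

/-! ### Reduction of the symmetric problem to the initial interval. -/

/-- A symmetric positive solution on `[0, (1 - h) / 2]` is positive, has positive initial slope and
satisfies a Robin condition at the right end; on the middle interval it is a multiple of `D`. -/
lemma IsPositiveSolution.symmetric_data {p h lam : ℝ} {u D D' : ℝ → ℝ} (hp : 1 < p)
    (hh : h ∈ Ioo (0 : ℝ) 1) (hD : ∀ x, HasDerivAt D (D' x) x)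
    (hD' : ∀ x, HasDerivAt D' (-(lam * D x)) x) (hDsymm : ∀ x, D' (1 - x) = -D' x)
    (hDpos : ∀ x ∈ Icc (0 : ℝ) 1, 0 < D x)
    (hu : IsPositiveSolution (weight h) p lam u) (hsymm : IsSymmetric u) :
    ∃ v : ℝ → ℝ,
      (∀ x ∈ Icc 0 ((1 - h) / 2), HasDerivWithinAt u (v x) (Icc 0 ((1 - h) / 2)) x) ∧
      (∀ x ∈ Icc 0 ((1 - h) / 2),
        HasDerivWithinAt v (-(lam * u x + u x ^ p)) (Icc 0 ((1 - h) / 2)) x) ∧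
      0 < v 0 ∧ (∀ x ∈ Ioc 0 ((1 - h) / 2), 0 < u x) ∧
      v ((1 - h) / 2) * D ((1 - h) / 2) - u ((1 - h) / 2) * D' ((1 - h) / 2) = 0 ∧
      ∀ x ∈ Icc ((1 - h) / 2) (1 / 2), u x / D x = u ((1 - h) / 2) / D ((1 - h) / 2) := by
  obtain ⟨v, huv, hl, hm, -⟩ := hu.toIsSolution.exists_deriv (by linarith) hh
  obtain ⟨h0, h1⟩ := hh
  set b := (1 - h) / 2 with hb
  have hb0 : 0 < b := by simp only [b]; linarith
  have hb2 : b < 1 / 2 := by simp only [b]; linarith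
  have hbm : (1 + h) / 2 = 1 - b := by simp only [b]; ring
  rw [hbm] at hm
  have hDd (s : Set ℝ) (x : ℝ) : HasDerivWithinAt D (D' x) s x := (hD x).hasDerivWithinAt
  have hDd' (s : Set ℝ) (x : ℝ) : HasDerivWithinAt D' (-(lam * D x)) s x :=
    (hD' x).hasDerivWithinAt
  have hul := hasDerivWithinAt_Icc_mono huv le_rfl (by linarith : b ≤ 1)
  have hum := hasDerivWithinAt_Icc_mono huv hb0.le (by linarith : 1 - b ≤ 1)
  have hv2 : v (1 / 2) = 0 := by
    have hnhds : Icc (0 : ℝ) 1 ∈ nhds (1 / 2) := Icc_mem_nhds (by norm_num) (by norm_num)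
    have d1 := (huv (1 / 2) ⟨by norm_num, by norm_num⟩).hasDerivAt hnhds
    have d2 : HasDerivAt (fun x => u (1 - x)) (-v (1 / 2)) (1 / 2) := by
      have d3 : HasDerivAt u (v (1 / 2)) (1 - 1 / 2) := by
        rwa [show (1 : ℝ) - 1 / 2 = 1 / 2 by norm_num]
      simpa using d3.comp_const_sub 1 (1 / 2)
    have heq : (fun x => u (1 - x)) =ᶠ[nhds (1 / 2)] u :=
      Filter.eventually_of_mem hnhds hsymm
    have := (d2.congr_of_eventuallyEq heq.symm).unique d1
    linarith
  have hD2 : D' (1 / 2) = 0 := by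
    have := hDsymm (1 / 2)
    norm_num at this
    norm_num
    linarith
  set α : ℝ → ℝ := fun x => v x * D x - u x * D' x with hα
  have hαm : ∀ x ∈ Icc b (1 - b), α x = 0 := by
    have hd : ∀ x ∈ Icc b (1 - b), HasDerivWithinAt α 0 (Icc b (1 - b)) x := by
      intro x hx
      convert! hasDerivWithinAt_wronskian (hum x hx) (hm x hx) (hDd _ x) (hDd' _ x) using 1
      ring
    intro x hx
    rw [eq_of_hasDerivWithinAt_zero hd (fun _ _ => rfl) hx
      (⟨hb2.le, by linarith⟩ : (1 / 2 : ℝ) ∈ Icc b (1 - b))]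
    simp only [hα, hv2, hD2, zero_mul, mul_zero, sub_zero]
  have hDne {c d : ℝ} (hc : 0 ≤ c) (hd : d ≤ 1) : ∀ x ∈ Icc c d, D x ≠ 0 := fun x hx =>
    (hDpos x (Icc_subset_Icc hc hd hx)).ne'
  have hmid : ∀ x ∈ Icc b (1 / 2), u x / D x = u b / D b := fun x hx =>
    div_eq_div_of_wronskian_eq_zero hum (fun x _ => hDd _ x) (hDne hb0.le (by linarith)) hαm
      ⟨hx.1, by linarith [hx.2]⟩ ⟨le_rfl, by linarith⟩
  have hαl : ∀ x ∈ Icc 0 b, HasDerivWithinAt α (-(u x ^ p * D x)) (Icc 0 b) x := by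
    intro x hx
    convert! hasDerivWithinAt_wronskian (hul x hx) (hl x hx) (hDd _ x) (hDd' _ x) using 1
    ring
  have hsub : Icc 0 b ⊆ Icc (0 : ℝ) 1 := Icc_subset_Icc_right (by linarith)
  have hanti : AntitoneOn α (Icc 0 b) := antitoneOn_Icc_of_nonpos hαl fun x hx =>
    neg_nonpos.2 (mul_nonneg (Real.rpow_nonneg (hu.nonneg x (hsub (Ioo_subset_Icc_self hx))) _)
      (hDpos x (hsub (Ioo_subset_Icc_self hx))).le)
  have hαb : α b = 0 := hαm b ⟨le_rfl, by linarith⟩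
  have hαnn : ∀ x ∈ Icc 0 b, 0 ≤ α x := fun x hx => by
    rw [← hαb]
    exact hanti hx ⟨hb0.le, le_rfl⟩ hx.2
  have hDl := hDne (c := 0) (d := b) le_rfl (by linarith)
  -- `(u / D)' = α / D²`, and `α` decreases to `α b = 0`.
  have hmono : MonotoneOn (fun x => u x / D x) (Icc 0 b) :=
    monotoneOn_Icc_of_nonneg (fun x hx => (hul x hx).fun_div (hDd _ x) (hDl x hx))
      (fun x hx => div_nonneg (hαnn x (Ioo_subset_Icc_self hx)) (sq_nonneg _))
  have hw0 : u 0 / D 0 = 0 := by rw [hu.left_zero, zero_div]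
  -- Otherwise `α 0 ≤ 0` squeezes `α` to zero on `[0,b]`, so `u / D` vanishes there, then up to
  -- `1/2`, then everywhere by symmetry.
  have hv0 : 0 < v 0 := by
    by_contra! hle
    have hα0 : α 0 ≤ 0 := by
      simp only [hα, hu.left_zero, zero_mul, sub_zero]
      exact mul_nonpos_of_nonpos_of_nonneg hle (hDpos 0 ⟨le_rfl, zero_le_one⟩).le
    have hαz : ∀ x ∈ Icc 0 b, α x = 0 := fun x hx =>
      le_antisymm ((hanti ⟨le_rfl, hb0.le⟩ hx hx.1).trans hα0) (hαnn x hx)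
    have hul0 : ∀ x ∈ Icc 0 b, u x / D x = 0 := fun x hx => by
      rw [← hw0]
      exact div_eq_div_of_wronskian_eq_zero hul (fun x _ => hDd _ x) hDl hαz hx
        ⟨le_rfl, hb0.le⟩
    have huh : ∀ x ∈ Icc (0 : ℝ) (1 / 2), u x = 0 := fun x hx => by
      have hDx := hDpos x ⟨hx.1, by linarith [hx.2]⟩
      have : u x / D x = 0 := by
        rcases le_total x b with hxb | hxb
        · exact hul0 x ⟨hx.1, hxb⟩
        · rw [hmid x ⟨hxb, hx.2⟩]
          exact hul0 b ⟨hb0.le, le_rfl⟩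
      exact (div_eq_zero_iff.1 this).resolve_right hDx.ne'
    obtain ⟨x, hx, hux⟩ := hu.nontrivial
    rcases le_total x (1 / 2) with h | h
    · exact hux (huh x ⟨hx.1, h⟩)
    · rw [← hsymm x hx] at hux
      exact hux (huh (1 - x) ⟨by linarith [hx.2], by linarith⟩)
  refine ⟨v, hul, hl, hv0, fun x hx => ?_, hαb, hmid⟩
  have hxm := Ioc_subset_Icc_self hx
  refine lt_of_le_of_ne (hu.nonneg x (hsub hxm)) fun h0x => ?_
  have hz : ∀ t ∈ Icc 0 x, u t = 0 := fun t ht => by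
    have htm : t ∈ Icc 0 b := ⟨ht.1, ht.2.trans hx.2⟩
    have := hmono htm hxm ht.2
    simp only [← h0x, zero_div] at this
    have h2 := (div_le_iff₀ (hDpos t (hsub htm))).1 this
    exact le_antisymm (by linarith) (hu.nonneg t (hsub htm))
  have := deriv_eq_zero_of_eqOn_const hx.1 (hasDerivWithinAt_Icc_mono hul le_rfl hx.2) hz
    ⟨le_rfl, hx.1.le⟩
  linarith

lemma IsPositiveSolution.eqOn_of_isSymmetric {p h lam : ℝ} {u y : ℝ → ℝ} (hp : 1 < p)
    (hh : h ∈ Ioo (0 : ℝ) 1)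
    (hu : IsPositiveSolution (weight h) p lam u) (husymm : IsSymmetric u)
    (hy : IsPositiveSolution (weight h) p lam y) (hysymm : IsSymmetric y) :
    EqOn u y (Icc 0 1) := by
  obtain ⟨D, D', hD, hD', -, hDsymm, hDpos⟩ :=
    exists_linear_profile (hu.lt_pi_sq (by linarith) hh)
  obtain ⟨u', hu1, hu2, hu0, hupos, huR, hum⟩ :=
    hu.symmetric_data hp hh hD hD' hDsymm hDpos husymm
  obtain ⟨y', hy1, hy2, hy0, hypos, hyR, hym⟩ :=
    hy.symmetric_data hp hh hD hD' hDsymm hDpos hysymm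
  obtain ⟨h0, h1⟩ := hh
  set b := (1 - h) / 2 with hb
  have hb0 : 0 < b := by simp only [b]; linarith
  have hb2 : b < 1 / 2 := by simp only [b]; linarith
  have hDb := hDpos b ⟨hb0.le, by linarith⟩
  -- Both solutions satisfy the same Robin condition, with coefficients given by `D`.
  have hR : u' b * y b - u b * y' b = 0 := by
    have : (u' b * y b - u b * y' b) * D b = 0 := by linear_combination y b * huR - u b * hyR
    exact (mul_eq_zero.1 this).resolve_right hDb.ne'
  have hs1 := not_slope_lt_of_wronskian_eq_zero hp hb0 hu1 hu2 hu.left_zero hupos hu0.le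
    hy1 hy2 hy.left_zero hypos hR
  have hs2 := not_slope_lt_of_wronskian_eq_zero hp hb0 hy1 hy2 hy.left_zero hypos hy0.le
    hu1 hu2 hu.left_zero hupos (by linarith)
  have hleft := eqOn_of_slope_eq hp.le hu1 hu2 (fun x hx => hu.nonneg x ⟨hx.1, by linarith [hx.2]⟩)
    hy1 hy2 (fun x hx => hy.nonneg x ⟨hx.1, by linarith [hx.2]⟩)
    (by rw [hu.left_zero, hy.left_zero]) (le_antisymm (not_lt.1 hs2) (not_lt.1 hs1))
  have hhalf : EqOn u y (Icc 0 (1 / 2)) := fun x hx => by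
    rcases le_total x b with hxb | hxb
    · exact hleft ⟨hx.1, hxb⟩
    · have hDx := hDpos x ⟨hx.1, by linarith [hx.2]⟩
      have e1 := hum x ⟨hxb, hx.2⟩
      rw [hleft ⟨hb0.le, le_rfl⟩, ← hym x ⟨hxb, hx.2⟩] at e1
      exact (div_left_inj' hDx.ne').1 e1
  intro x hx
  rcases le_total x (1 / 2) with h | h
  · exact hhalf ⟨hx.1, h⟩
  · rw [← husymm x hx, ← hysymm x hx]
    exact hhalf ⟨by linarith [hx.2], by linarith⟩

/-! ### Existence by shooting. -/

section MeanValue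

variable {f f' : ℝ → ℝ} {a b C : ℝ}

lemma sub_le_mul_of_deriv_le (hab : a ≤ b)
    (hf : ∀ x ∈ Icc a b, HasDerivWithinAt f (f' x) (Icc a b) x)
    (h : ∀ x ∈ Ioo a b, f' x ≤ C) : f b - f a ≤ C * (b - a) := by
  have hd : ∀ x ∈ Icc a b, HasDerivWithinAt (fun x => f x - C * x) (f' x - C) (Icc a b) x :=
    fun x hx => by
      simpa using (hf x hx).fun_sub ((hasDerivWithinAt_id x (Icc a b)).const_mul C)
  have := antitoneOn_Icc_of_nonpos hd (fun x hx => sub_nonpos.2 (h x hx))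
    ⟨le_rfl, hab⟩ ⟨hab, le_rfl⟩ hab
  simp only at this
  linarith

lemma mul_le_sub_of_le_deriv (hab : a ≤ b)
    (hf : ∀ x ∈ Icc a b, HasDerivWithinAt f (f' x) (Icc a b) x)
    (h : ∀ x ∈ Ioo a b, C ≤ f' x) : C * (b - a) ≤ f b - f a := by
  have := sub_le_mul_of_deriv_le (f := fun x => -f x) (C := -C) hab
    (fun x hx => (hf x hx).fun_neg) (fun x hx => neg_le_neg (h x hx))
  linarith

end MeanValue

/-- Truncation of a real number to `[0, M]`. -/
noncomputable def clamp (M z : ℝ) : ℝ := max 0 (min z M)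

section Clamp

variable {M : ℝ}

lemma clamp_mem (hM : 0 ≤ M) (z : ℝ) : clamp M z ∈ Icc 0 M :=
  ⟨le_max_left _ _, max_le hM (min_le_right _ _)⟩

lemma clamp_of_mem {z : ℝ} (hz : z ∈ Icc 0 M) : clamp M z = z := by
  rw [clamp, min_eq_left hz.2, max_eq_right hz.1]

lemma clamp_le {z c : ℝ} (hc : 0 ≤ c) (hz : z ≤ c) : clamp M z ≤ c :=
  max_le hc ((min_le_left _ _).trans hz)

lemma abs_clamp_sub_clamp_le (z y : ℝ) : |clamp M z - clamp M y| ≤ |z - y| := by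
  refine (abs_max_sub_max_le_max 0 (min z M) 0 (min y M)).trans ?_
  refine max_le (by simp) ((abs_min_sub_min_le_max z M y M).trans ?_)
  simp

lemma continuous_clamp : Continuous (clamp M) :=
  continuous_const.max (continuous_id.min continuous_const)

end Clamp

/-- The flow of a truncated version of the system `w' = α / D ^ 2`, `α' = -(D w) ^ p D`. -/
lemma exists_truncated_flow {p b d e A₁ M : ℝ} {D : ℝ → ℝ} (hp : 1 ≤ p) (hb : 0 ≤ b) (hd : 0 < d)
    (hA₁ : 0 ≤ A₁) (hM : 0 ≤ M) (hDc : ContinuousOn D (Icc 0 b))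
    (hDd : ∀ x ∈ Icc 0 b, d ≤ D x) (hDe : ∀ x ∈ Icc 0 b, D x ≤ e) :
    ∃ w α : ℝ → ℝ → ℝ, (∀ A, w A 0 = 0 ∧ α A 0 = A ∧
      (∀ x ∈ Icc 0 b, HasDerivWithinAt (w A) (clamp A₁ (α A x) / D x ^ 2) (Icc 0 b) x) ∧
      ∀ x ∈ Icc 0 b, HasDerivWithinAt (α A) (-(clamp M (D x * w A x) ^ p * D x)) (Icc 0 b) x) ∧
      Continuous fun A => α A b := by
  have he : 0 < e := (hd.trans_le (hDd 0 ⟨le_rfl, hb⟩)).trans_le (hDe 0 ⟨le_rfl, hb⟩)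
  -- Clamping makes the field bounded and globally Lipschitz in the state, so solutions exist on all
  -- of `[0,b]` and depend continuously on `A`.
  set F : ℝ → ℝ × ℝ → ℝ × ℝ := fun t z =>
    (clamp A₁ z.2 / D t ^ 2, -(clamp M (D t * z.1) ^ p * D t)) with hF
  have hpM : 0 ≤ p * M ^ (p - 1) := mul_nonneg (by linarith) (Real.rpow_nonneg hM _)
  set K : NNReal := ⟨1 / d ^ 2 + p * M ^ (p - 1) * e ^ 2, by positivity⟩
  have hKv : (K : ℝ) = 1 / d ^ 2 + p * M ^ (p - 1) * e ^ 2 := rfl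
  set L : NNReal := ⟨A₁ / d ^ 2 + M ^ p * e, by positivity⟩
  have hLv : (L : ℝ) = A₁ / d ^ 2 + M ^ p * e := rfl
  set B : NNReal := ⟨b, hb⟩
  have hDpos (t : ℝ) (ht : t ∈ Icc 0 b) : 0 < D t := hd.trans_le (hDd t ht)
  have hFL : ∀ t ∈ Icc 0 b, LipschitzWith K (F t) := by
    intro t ht
    refine LipschitzWith.of_dist_le_mul fun z y => ?_
    have hDt := hDpos t ht
    have m1 : |z.1 - y.1| ≤ dist z y := le_max_left _ _
    have m2 : |z.2 - y.2| ≤ dist z y := le_max_right _ _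
    have m0 : 0 ≤ dist z y := dist_nonneg
    have hq1 : 1 / D t ^ 2 ≤ 1 / d ^ 2 :=
      one_div_le_one_div_of_le (by positivity) (pow_le_pow_left₀ hd.le (hDd t ht) 2)
    refine max_le ?_ ?_
    · rw [Real.dist_eq, hF]
      simp only
      rw [← sub_div, abs_div, abs_of_pos (by positivity : 0 < D t ^ 2), div_eq_mul_one_div, mul_comm]
      calc 1 / D t ^ 2 * |clamp A₁ z.2 - clamp A₁ y.2|
          ≤ 1 / d ^ 2 * dist z y :=
            mul_le_mul hq1 ((abs_clamp_sub_clamp_le _ _).trans m2) (abs_nonneg _) (by positivity)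
        _ ≤ K * dist z y := by
            refine mul_le_mul_of_nonneg_right ?_ m0
            rw [hKv]
            exact le_add_of_nonneg_right (by positivity)
    · rw [Real.dist_eq, hF]
      simp only
      have e1 := abs_rpow_sub_rpow_le hp (clamp_mem hM (D t * z.1)) (clamp_mem hM (D t * y.1))
      have e2 : |clamp M (D t * z.1) - clamp M (D t * y.1)| ≤ e * dist z y := by
        refine (abs_clamp_sub_clamp_le _ _).trans ?_
        rw [← mul_sub, abs_mul, abs_of_pos hDt]
        exact mul_le_mul (hDe t ht) m1 (abs_nonneg _) he.le
      calc |-(clamp M (D t * z.1) ^ p * D t) - -(clamp M (D t * y.1) ^ p * D t)|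
          = |clamp M (D t * z.1) ^ p - clamp M (D t * y.1) ^ p| * D t := by
            rw [← abs_of_pos hDt, ← abs_mul, abs_of_pos hDt, ← abs_neg]
            congr 1
            ring
        _ ≤ p * M ^ (p - 1) * (e * dist z y) * e :=
            mul_le_mul (e1.trans (mul_le_mul_of_nonneg_left e2 hpM)) (hDe t ht) hDt.le
              (by positivity)
        _ = p * M ^ (p - 1) * e ^ 2 * dist z y := by ring
        _ ≤ K * dist z y := by
            refine mul_le_mul_of_nonneg_right ?_ m0
            rw [hKv]
            exact le_add_of_nonneg_left (by positivity)
  have hFb : ∀ t ∈ Icc 0 b, ∀ z, ‖F t z‖ ≤ L := by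
    intro t ht z
    have hDt := hDpos t ht
    have c1 := clamp_mem hA₁ z.2
    have c2 := clamp_mem hM (D t * z.1)
    have b1 : clamp A₁ z.2 / D t ^ 2 ≤ A₁ / d ^ 2 :=
      div_le_div₀ hA₁ c1.2 (by positivity) (pow_le_pow_left₀ hd.le (hDd t ht) 2)
    have b2 : clamp M (D t * z.1) ^ p * D t ≤ M ^ p * e :=
      mul_le_mul (Real.rpow_le_rpow c2.1 c2.2 (by linarith)) (hDe t ht) hDt.le (by positivity)
    have n1 : 0 ≤ A₁ / d ^ 2 := by positivity
    have n2 : 0 ≤ M ^ p * e := by positivity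
    refine max_le ?_ ?_
    · rw [Real.norm_of_nonneg (div_nonneg c1.1 (sq_nonneg _))]
      rw [hLv]
      linarith
    · rw [norm_neg, Real.norm_of_nonneg (mul_nonneg (Real.rpow_nonneg c2.1 _) hDt.le)]
      rw [hLv]
      linarith
  have hsol (A : ℝ) : ∃ γ : ℝ → ℝ × ℝ, γ 0 = (0, A) ∧
      ∀ t ∈ Icc 0 b, HasDerivWithinAt γ (F t (γ t)) (Icc 0 b) t := by
    -- With speed at most `L`, a solution stays in the ball of radius `L b` for time `b`.
    refine IsPicardLindelof.exists_eq_forall_mem_Icc_hasDerivWithinAt₀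
      (t₀ := ⟨0, le_rfl, hb⟩) (a := L * B) (L := L) (K := K)
      ⟨fun t ht => (hFL t ht).lipschitzOnWith, fun z _ => ?_, fun t ht z _ => hFb t ht z, ?_⟩
    · refine ContinuousOn.prodMk (continuousOn_const.div (hDc.pow 2)
        fun t ht => (pow_pos (hDpos t ht) 2).ne') ?_
      refine ContinuousOn.neg (ContinuousOn.mul (ContinuousOn.rpow_const ?_
        fun _ _ => Or.inr (by linarith)) hDc)
      exact continuous_clamp.comp_continuousOn (hDc.mul continuousOn_const)
    · rw [NNReal.coe_mul, NNReal.coe_zero, sub_zero, sub_zero, max_eq_left (by exact hb),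
        sub_zero]
      exact le_refl ((L : ℝ) * b)
  choose γ hγ0 hγ using hsol
  have hγc (A : ℝ) : ContinuousOn (γ A) (Icc 0 b) := fun t ht => (hγ A t ht).continuousWithinAt
  refine ⟨fun A t => (γ A t).1, fun A t => (γ A t).2, fun A => ⟨by simp [hγ0], by simp [hγ0],
    fun x hx => ?_, fun x hx => ?_⟩, ?_⟩
  · exact hasFDerivAt_fst.comp_hasDerivWithinAt x (hγ A x hx)
  · exact hasFDerivAt_snd.comp_hasDerivWithinAt x (hγ A x hx)
  · have hdist (A A' : ℝ) :
        dist (γ A b).2 (γ A' b).2 ≤ (Real.exp (K * b)).toNNReal * dist A A' := by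
      have := dist_le_of_trajectories_ODE_of_mem (v := F) (s := fun _ => univ) (K := K)
        (a := 0) (b := b) (δ := dist A A')
        (fun t ht => (hFL t (Ico_subset_Icc_self ht)).lipschitzOnWith) (hγc A)
        (fun t ht => (hγ A t (Ico_subset_Icc_self ht)).mono_of_mem_nhdsWithin
          (Icc_mem_nhdsGE_of_mem ht))
        (fun _ _ => mem_univ _) (hγc A')
        (fun t ht => (hγ A' t (Ico_subset_Icc_self ht)).mono_of_mem_nhdsWithin
          (Icc_mem_nhdsGE_of_mem ht))
        (fun _ _ => mem_univ _) (by simp [hγ0, Prod.dist_eq]) b ⟨hb, le_rfl⟩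
      rw [sub_zero] at this
      rw [Real.coe_toNNReal _ (Real.exp_nonneg _), mul_comm]
      exact (le_max_right _ _).trans this
    exact (LipschitzWith.of_dist_le_mul hdist).continuous

/-- A priori bound for nondecreasing solutions of `w' = α / D ^ 2`, `α' = -(D w) ^ p D`. -/
lemma exists_initial_bound {p b d e : ℝ} {D : ℝ → ℝ} (hp : 1 < p) (hb : 0 < b) (hd : 0 < d)
    (hDd : ∀ x ∈ Icc 0 b, d ≤ D x) (hDe : ∀ x ∈ Icc 0 b, D x ≤ e) :
    ∃ A₁ > 0, ∀ w α : ℝ → ℝ, w 0 = 0 →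
      (∀ x ∈ Icc 0 b, HasDerivWithinAt w (α x / D x ^ 2) (Icc 0 b) x) →
      (∀ x ∈ Icc 0 b, HasDerivWithinAt α (-((D x * w x) ^ p * D x)) (Icc 0 b) x) →
      (∀ x ∈ Icc 0 b, 0 ≤ α x) → α 0 < A₁ := by
  have he : 0 < e := (hd.trans_le (hDd 0 ⟨le_rfl, hb.le⟩)).trans_le (hDe 0 ⟨le_rfl, hb.le⟩)
  set c := b / 2 with hc
  have hc0 : 0 < c := by positivity
  have hcb : c ≤ b := by linarith
  -- On `[c,b]` the drop of `α` gives `d^p w(c)^p d c ≤ α c`; on `[0,c]` the growth of `w` gives `α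
  -- c * c / e² ≤ w c`. Together `κ w(c)^p ≤ w c`, so `w c ≤ R`.
  set κ := d ^ p * d * c * c / e ^ 2 with hκ
  have hκ0 : 0 < κ := by positivity
  set R := (1 / κ) ^ (1 / (p - 1)) with hR
  have hR0 : 0 ≤ R := by positivity
  refine ⟨R * e ^ 2 / c + (e * R) ^ p * e * c + 1, by positivity, ?_⟩
  intro w α w0 hw hα hαnn
  have hDpos (t : ℝ) (ht : t ∈ Icc 0 b) : 0 < D t := hd.trans_le (hDd t ht)
  have hwm : MonotoneOn w (Icc 0 b) := monotoneOn_Icc_of_nonneg hw fun x hx =>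
    div_nonneg (hαnn x (Ioo_subset_Icc_self hx)) (sq_nonneg _)
  have hwnn : ∀ x ∈ Icc 0 b, 0 ≤ w x := fun x hx => by
    rw [← w0]
    exact hwm ⟨le_rfl, hb.le⟩ hx hx.1
  have hαa : AntitoneOn α (Icc 0 b) := antitoneOn_Icc_of_nonpos hα fun x hx => by
    have h1 := hDpos x (Ioo_subset_Icc_self hx)
    have h2 := hwnn x (Ioo_subset_Icc_self hx)
    exact neg_nonpos.2 (by positivity)
  have hcm : c ∈ Icc 0 b := ⟨hc0.le, hcb⟩
  have hαc := hαnn c hcm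
  have hwc := hwnn c hcm
  have i1 : α c / e ^ 2 * (c - 0) ≤ w c - w 0 := by
    refine mul_le_sub_of_le_deriv hc0.le (hasDerivWithinAt_Icc_mono hw le_rfl hcb) fun x hx => ?_
    have hxm : x ∈ Icc 0 b := ⟨hx.1.le, hx.2.le.trans hcb⟩
    have h1 := hDpos x hxm
    exact div_le_div₀ (hαnn x hxm) (hαa hxm hcm hx.2.le) (by positivity)
      (pow_le_pow_left₀ h1.le (hDe x hxm) 2)
  have i2 : α b - α c ≤ -((d * w c) ^ p * d) * (b - c) := by
    refine sub_le_mul_of_deriv_le hcb (hasDerivWithinAt_Icc_mono hα hc0.le le_rfl) fun x hx => ?_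
    have hxm : x ∈ Icc 0 b := ⟨hc0.le.trans hx.1.le, hx.2.le⟩
    have h1 := hDpos x hxm
    have h2 := hwm hcm hxm hx.1.le
    exact neg_le_neg (mul_le_mul (Real.rpow_le_rpow (by positivity)
      (mul_le_mul (hDd x hxm) h2 hwc h1.le) (by linarith)) (hDd x hxm) hd.le
      (Real.rpow_nonneg (mul_nonneg h1.le (hwnn x hxm)) _))
  have i3 : -((e * w c) ^ p * e) * (c - 0) ≤ α c - α 0 := by
    refine mul_le_sub_of_le_deriv hc0.le (hasDerivWithinAt_Icc_mono hα le_rfl hcb) fun x hx => ?_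
    have hxm : x ∈ Icc 0 b := ⟨hx.1.le, hx.2.le.trans hcb⟩
    have h1 := hDpos x hxm
    have h2 := hwm hxm hcm hx.2.le
    have h3 := hwnn x hxm
    exact neg_le_neg (mul_le_mul (Real.rpow_le_rpow (by positivity)
      (mul_le_mul (hDe x hxm) h2 h3 he.le) (by linarith)) (hDe x hxm) h1.le (by positivity))
  have hαb := hαnn b ⟨hb.le, le_rfl⟩
  have hbc : b - c = c := by rw [hc]; ring
  rw [hbc] at i2
  rw [w0, sub_zero, sub_zero] at i1
  rw [sub_zero] at i3
  have hαc_le : α c ≤ w c * e ^ 2 / c := by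
    rw [le_div_iff₀ hc0]
    have := mul_le_mul_of_nonneg_right i1 (sq_nonneg e)
    have h4 : α c / e ^ 2 * c * e ^ 2 = α c * c := by field_simp
    linarith
  have hwR : w c ≤ R := by
    rcases eq_or_lt_of_le hwc with h | hpos
    · rwa [← h]
    have h1 : κ * w c ^ p ≤ w c := by
      rw [Real.mul_rpow hd.le hwc] at i2
      have h2 : d ^ p * w c ^ p * d * c ≤ α c := by linarith
      calc κ * w c ^ p = (d ^ p * w c ^ p * d * c) / e ^ 2 * c := by rw [hκ]; ring
        _ ≤ α c / e ^ 2 * c := by gcongr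
        _ ≤ w c := i1
    have h2 : w c ^ (p - 1) ≤ 1 / κ := by
      rw [Real.rpow_sub_one hpos.ne', div_le_div_iff₀ hpos hκ0]
      linarith
    calc w c = (w c ^ (p - 1)) ^ (1 / (p - 1)) := by
          rw [← Real.rpow_mul hwc, mul_one_div_cancel (by linarith), Real.rpow_one]
      _ ≤ R := Real.rpow_le_rpow (by positivity) h2 (one_div_nonneg.2 (by linarith))
  have h5 : w c * e ^ 2 / c ≤ R * e ^ 2 / c := by gcongr
  have h6 : (e * w c) ^ p * e * c ≤ (e * R) ^ p * e * c := by gcongr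
  linarith

/-- The shooting argument: a solution of `w' = α / D ^ 2`, `α' = -(D w) ^ p D` with `w 0 = 0`,
`α b = 0`. -/
lemma exists_shooting {p b : ℝ} {D : ℝ → ℝ} (hp : 1 < p) (hb : 0 < b)
    (hDc : ContinuousOn D (Icc 0 b)) (hDpos : ∀ x ∈ Icc 0 b, 0 < D x) :
    ∃ w α : ℝ → ℝ, w 0 = 0 ∧ 0 < α 0 ∧ α b = 0 ∧ (∀ x ∈ Icc 0 b, 0 ≤ w x) ∧
      (∀ x ∈ Icc 0 b, HasDerivWithinAt w (α x / D x ^ 2) (Icc 0 b) x) ∧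
      ∀ x ∈ Icc 0 b, HasDerivWithinAt α (-((D x * w x) ^ p * D x)) (Icc 0 b) x := by
  obtain ⟨x₁, hx₁, hmin⟩ := isCompact_Icc.exists_isMinOn ⟨0, le_rfl, hb.le⟩ hDc
  obtain ⟨x₂, hx₂, hmax⟩ := isCompact_Icc.exists_isMaxOn ⟨0, le_rfl, hb.le⟩ hDc
  set d := D x₁
  set e := D x₂
  have hd : 0 < d := hDpos x₁ hx₁
  have he : 0 < e := hDpos x₂ hx₂
  have hDd : ∀ x ∈ Icc 0 b, d ≤ D x := fun x hx => hmin hx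
  have hDe : ∀ x ∈ Icc 0 b, D x ≤ e := fun x hx => hmax hx
  obtain ⟨A₁, hA₁, hbound⟩ := exists_initial_bound hp hb hd hDd hDe
  -- Bounds `D w` for all `0 ≤ A ≤ A₁`, so when `α b ≥ 0` neither clamp is active (`htrue`).
  set M := e * (A₁ / d ^ 2 * b)
  have hM : 0 ≤ M := by positivity
  obtain ⟨w, α, hwα, hcont⟩ := exists_truncated_flow hp.le hb.le hd hA₁.le hM hDc hDd hDe
  have h0m : (0 : ℝ) ∈ Icc 0 b := ⟨le_rfl, hb.le⟩
  have hbm : b ∈ Icc 0 b := ⟨hb.le, le_rfl⟩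
  have hwnn (A : ℝ) : ∀ x ∈ Icc 0 b, 0 ≤ w A x := fun x hx => by
    obtain ⟨w0, -, hw, -⟩ := hwα A
    rw [← w0]
    exact monotoneOn_Icc_of_nonneg hw
      (fun x _ => div_nonneg (clamp_mem hA₁.le _).1 (sq_nonneg _)) h0m hx hx.1
  have hanti (A : ℝ) : AntitoneOn (α A) (Icc 0 b) :=
    antitoneOn_Icc_of_nonpos (hwα A).2.2.2 fun x hx =>
      neg_nonpos.2 (mul_nonneg (Real.rpow_nonneg (clamp_mem hM _).1 _)
        (hDpos x (Ioo_subset_Icc_self hx)).le)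
  have hwle (A : ℝ) (hA : 0 ≤ A) : ∀ x ∈ Icc 0 b, w A x ≤ A / d ^ 2 * b := fun x hx => by
    obtain ⟨w0, α0, hw, -⟩ := hwα A
    have := sub_le_mul_of_deriv_le (C := A / d ^ 2) hx.1
      (hasDerivWithinAt_Icc_mono hw le_rfl hx.2) fun y hy => by
        have hym : y ∈ Icc 0 b := ⟨hy.1.le, hy.2.le.trans hx.2⟩
        refine div_le_div₀ hA (clamp_le hA ?_) (by positivity)
          (pow_le_pow_left₀ hd.le (hDd y hym) 2)
        rw [← α0]
        convert! hanti A h0m hym hym.1 using 1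
        rw [α0]
    rw [w0, sub_zero, sub_zero] at this
    refine this.trans ?_
    have := hx.2
    gcongr
  have htrue (A : ℝ) (hA0 : 0 ≤ A) (hA : A ≤ A₁) (hαb : 0 ≤ α A b) :
      (∀ x ∈ Icc 0 b, 0 ≤ α A x) ∧
      (∀ x ∈ Icc 0 b, HasDerivWithinAt (w A) (α A x / D x ^ 2) (Icc 0 b) x) ∧
      ∀ x ∈ Icc 0 b, HasDerivWithinAt (α A) (-((D x * w A x) ^ p * D x)) (Icc 0 b) x := by
    obtain ⟨w0, α0, hw, hα⟩ := hwα A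
    have hαnn : ∀ x ∈ Icc 0 b, 0 ≤ α A x := fun x hx => hαb.trans (hanti A hx hbm hx.2)
    refine ⟨hαnn, fun x hx => ?_, fun x hx => ?_⟩
    · have h1 : α A x ≤ A₁ := (hanti A h0m hx hx.1).trans (by rwa [α0])
      have h2 := hw x hx
      rwa [clamp_of_mem ⟨hαnn x hx, h1⟩] at h2
    · have h1 : D x * w A x ≤ M := by
        refine mul_le_mul (hDe x hx) ((hwle A hA0 x hx).trans ?_) (hwnn A x hx) he.le
        gcongr
      have h2 := hα x hx
      rwa [clamp_of_mem ⟨mul_nonneg (hDpos x hx).le (hwnn A x hx), h1⟩] at h2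
  have hlarge : α A₁ b < 0 := by
    by_contra! hαb
    obtain ⟨h1, h2, h3⟩ := htrue A₁ hA₁.le le_rfl hαb
    have := hbound _ _ (hwα A₁).1 h2 h3 h1
    rw [(hwα A₁).2.1] at this
    exact lt_irrefl _ this
  obtain ⟨A₀, hA₀, hA₀₁, hsmall⟩ : ∃ A₀ > 0, A₀ ≤ A₁ ∧ 0 < α A₀ b := by
    -- The total drop of `α` is at most `q A^p`; `r` is chosen so that `q r^(p-1) = 1/2`, keeping
    -- the drop below `A`.
    set q := (e * (1 / d ^ 2 * b)) ^ p * e * b with hq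
    have hq0 : 0 < q := by positivity
    set r := (1 / (2 * q)) ^ (1 / (p - 1)) with hr
    have hr0 : 0 < r := by positivity
    have hrp : r ^ (p - 1) = 1 / (2 * q) := by
      rw [hr, ← Real.rpow_mul (by positivity), one_div_mul_cancel (by linarith), Real.rpow_one]
    set A := min A₁ r with hA
    have hA0 : 0 < A := lt_min hA₁ hr0
    refine ⟨A, hA0, min_le_left _ _, ?_⟩
    have h1 : A ^ (p - 1) ≤ 1 / (2 * q) := by
      rw [← hrp]
      exact Real.rpow_le_rpow hA0.le (min_le_right _ _) (by linarith)
    have h2 : q * A ^ p < A := by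
      have h3 : A ^ p = A ^ (p - 1) * A := by
        rw [Real.rpow_sub_one hA0.ne']
        field_simp
      have h4 : q * A ^ (p - 1) ≤ 1 / 2 := by
        calc q * A ^ (p - 1) ≤ q * (1 / (2 * q)) := by gcongr
          _ = 1 / 2 := by field_simp
      rw [h3, ← mul_assoc]
      nlinarith
    obtain ⟨w0, α0, hw, hα⟩ := hwα A
    have h5 := mul_le_sub_of_le_deriv (C := -((e * (A / d ^ 2 * b)) ^ p * e)) hb.le hα
      fun x hx => by
        have hxm := Ioo_subset_Icc_self hx
        have hDx := hDpos x hxm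
        have hc0 := (clamp_mem hM (D x * w A x)).1
        refine neg_le_neg (mul_le_mul (Real.rpow_le_rpow hc0 (clamp_le (by positivity) ?_)
          (by linarith)) (hDe x hxm) hDx.le (by positivity))
        exact mul_le_mul (hDe x hxm) (hwle A hA0.le x hxm) (hwnn A x hxm) he.le
    have h6 : (e * (A / d ^ 2 * b)) ^ p * e * b = q * A ^ p := by
      rw [show e * (A / d ^ 2 * b) = e * (1 / d ^ 2 * b) * A by ring,
        Real.mul_rpow (by positivity) hA0.le, hq]
      ring
    rw [α0, sub_zero] at h5
    linarith
  obtain ⟨A, hA, hAb⟩ := intermediate_value_Icc' hA₀₁ hcont.continuousOn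
    ⟨hlarge.le, hsmall.le⟩
  obtain ⟨-, h2, h3⟩ := htrue A (hA₀.le.trans hA.1) hA.2 hAb.ge
  refine ⟨w A, α A, (hwα A).1, ?_, hAb, hwnn A, h2, h3⟩
  rw [(hwα A).2.1]
  exact hA₀.trans_le hA.1

/-! ### Extension to `[0,1]` by reflection. -/

section Extension

variable {f f' : ℝ → ℝ} {a b x : ℝ}

lemma exists_lipschitzOnWith_of_continuousOn_deriv
    (hf : ∀ x ∈ Icc a b, HasDerivWithinAt f (f' x) (Icc a b) x)
    (hf' : ContinuousOn f' (Icc a b)) : ∃ K, LipschitzOnWith K f (Icc a b) := by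
  obtain ⟨C, hC⟩ := isCompact_Icc.exists_bound_of_continuousOn hf'
  refine ⟨C.toNNReal, (convex_Icc a b).lipschitzOnWith_of_nnnorm_hasDerivWithin_le hf
    fun x hx => ?_⟩
  rw [← NNReal.coe_le_coe, coe_nnnorm]
  exact (hC x hx).trans (Real.le_coe_toNNReal C)

lemma absolutelyContinuousOnInterval_of_continuousOn_deriv (hab : a ≤ b)
    (hf : ∀ x ∈ Icc a b, HasDerivWithinAt f (f' x) (Icc a b) x)
    (hf' : ContinuousOn f' (Icc a b)) : AbsolutelyContinuousOnInterval f a b := by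
  obtain ⟨K, hK⟩ := exists_lipschitzOnWith_of_continuousOn_deriv hf hf'
  exact LipschitzOnWith.absolutelyContinuousOnInterval (K := K) (by rwa [uIcc_of_le hab])

lemma hasDerivWithinAt_comp_min_of_lt
    (hf : ∀ x ∈ Icc 0 b, HasDerivWithinAt f (f' x) (Icc 0 b) x) (hx0 : 0 ≤ x) (hxb : x < b) :
    HasDerivWithinAt (fun x => f (min x b)) (f' x) (Icc 0 1) x := by
  have h1 : HasDerivWithinAt (fun x => f (min x b)) (f' x) (Icc 0 b) x :=
    (hf x ⟨hx0, hxb.le⟩).congr (fun y hy => by rw [min_eq_left hy.2]) (by rw [min_eq_left hxb.le])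
  refine h1.mono_of_mem_nhdsWithin ?_
  filter_upwards [self_mem_nhdsWithin, mem_nhdsWithin_of_mem_nhds (Iio_mem_nhds hxb)] with y hy hyb
  exact ⟨hy.1, le_of_lt hyb⟩

lemma hasDerivAt_comp_min_of_gt (hxb : b < x) :
    HasDerivAt (fun x => f (min x b)) 0 x := by
  refine (hasDerivAt_const x (f b)).congr_of_eventuallyEq ?_
  filter_upwards [Ioi_mem_nhds hxb] with y hy
  rw [min_eq_right (le_of_lt hy)]

/-- Freezing `f` at its value at `b` creates no corner because `f' b = 0`; for `w` this is the
condition `α b = 0`. -/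
lemma hasDerivWithinAt_comp_min
    (hf : ∀ x ∈ Icc 0 b, HasDerivWithinAt f (f' x) (Icc 0 b) x) (hf'b : f' b = 0)
    (hb0 : 0 ≤ b) (hb1 : b ≤ 1) (hx : x ∈ Icc (0 : ℝ) 1) :
    HasDerivWithinAt (fun x => f (min x b)) (f' (min x b)) (Icc 0 1) x := by
  rcases lt_trichotomy x b with h | h | h
  · rw [min_eq_left h.le]
    exact hasDerivWithinAt_comp_min_of_lt hf hx.1 h
  · rw [h, min_self, ← Icc_union_Icc_eq_Icc hb0 hb1]
    refine HasDerivWithinAt.union ?_ ?_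
    · exact (hf b ⟨hb0, le_rfl⟩).congr (fun y hy => by rw [min_eq_left hy.2]) (by rw [min_self])
    · rw [hf'b]
      exact (hasDerivWithinAt_const b _ (f b)).congr (fun y hy => by rw [min_eq_right hy.1])
        (by rw [min_self])
  · rw [min_eq_right h.le, hf'b]
    exact (hasDerivAt_comp_min_of_gt h).hasDerivWithinAt

lemma hasDerivWithinAt_comp_one_sub (hf : HasDerivWithinAt f a (Icc 0 1) (1 - x)) :
    HasDerivWithinAt (fun x => f (1 - x)) (-a) (Icc 0 1) x := by
  have h1 : HasDerivWithinAt (fun x : ℝ => 1 - x) (-1) (Icc 0 1) x :=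
    (hasDerivWithinAt_id x _).const_sub 1
  convert! hf.comp x h1 (fun y hy => ⟨by linarith [hy.2], by linarith [hy.1]⟩) using 1
  ring

end Extension

/-- A solution of the half problem with the right boundary condition extends, by a multiple of `D`
and by reflection, to a symmetric positive solution. -/
lemma exists_symmetric_of_shooting {p h lam : ℝ} {D D' w α : ℝ → ℝ} (hp : 1 < p)
    (hh : h ∈ Ioo (0 : ℝ) 1) (hD : ∀ x, HasDerivAt D (D' x) x)
    (hD' : ∀ x, HasDerivAt D' (-(lam * D x)) x) (hDs : ∀ x, D (1 - x) = D x)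
    (hDpos : ∀ x ∈ Icc (0 : ℝ) 1, 0 < D x) (w0 : w 0 = 0) (α0 : 0 < α 0)
    (αb : α ((1 - h) / 2) = 0) (wnn : ∀ x ∈ Icc 0 ((1 - h) / 2), 0 ≤ w x)
    (hw : ∀ x ∈ Icc 0 ((1 - h) / 2),
      HasDerivWithinAt w (α x / D x ^ 2) (Icc 0 ((1 - h) / 2)) x)
    (hα : ∀ x ∈ Icc 0 ((1 - h) / 2),
      HasDerivWithinAt α (-((D x * w x) ^ p * D x)) (Icc 0 ((1 - h) / 2)) x) :
    ∃ u, IsPositiveSolution (weight h) p lam u ∧ IsSymmetric u := by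
  obtain ⟨h0, h1⟩ := hh
  set b := (1 - h) / 2 with hb
  have hb0 : 0 < b := by simp only [b]; linarith
  have hb2 : b < 1 / 2 := by simp only [b]; linarith
  have hbm : (1 + h) / 2 = 1 - b := by simp only [b]; ring
  have hDne (x : ℝ) (hx : x ∈ Icc (0 : ℝ) 1) : D x ≠ 0 := (hDpos x hx).ne'
  have hDc : Continuous D := continuous_iff_continuousAt.2 fun x => (hD x).continuousAt
  set φ : ℝ → ℝ := fun x => α (min x b) with hφ
  -- One formula for three pieces: `w` on the left, the constant `w b` in the middle, the reflected
  -- `w` on the right. Correspondingly `A = D² W'`.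
  set W : ℝ → ℝ := fun x => w (min x b) + w (min (1 - x) b) - w b with hWdef
  set A : ℝ → ℝ := fun x => φ x - φ (1 - x) with hA
  have Wl (x : ℝ) (hx : x ≤ b) : W x = w x := by
    simp only [hWdef]
    rw [min_eq_left hx, min_eq_right (by linarith)]
    ring
  have Wr (x : ℝ) (hx : b ≤ x) : W x = w (min (1 - x) b) := by
    simp only [hWdef]
    rw [min_eq_right hx]
    ring
  have Wnn (x : ℝ) (hx : x ∈ Icc (0 : ℝ) 1) : 0 ≤ W x := by
    rcases le_total x b with hxb | hxb
    · rw [Wl x hxb]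
      exact wnn x ⟨hx.1, hxb⟩
    · rw [Wr x hxb]
      exact wnn _ ⟨le_min (by linarith [hx.2]) hb0.le, min_le_right _ _⟩
  have Wsymm (x : ℝ) : W (1 - x) = W x := by
    simp only [hWdef]
    rw [sub_sub_cancel]
    ring
  have hφD (x : ℝ) : α (min x b) / D (min x b) ^ 2 = φ x / D x ^ 2 := by
    rcases le_total x b with hxb | hxb
    · simp only [hφ]
      rw [min_eq_left hxb]
    · simp only [hφ]
      rw [min_eq_right hxb, αb, zero_div, zero_div]
  have hf (x : ℝ) (hx : x ∈ Icc (0 : ℝ) 1) :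
      HasDerivWithinAt (fun x => w (min x b)) (φ x / D x ^ 2) (Icc 0 1) x := by
    rw [← hφD]
    exact hasDerivWithinAt_comp_min (f' := fun x => α x / D x ^ 2) hw (by simp [αb]) hb0.le
      (by linarith) hx
  have hW (x : ℝ) (hx : x ∈ Icc (0 : ℝ) 1) : HasDerivWithinAt W (A x / D x ^ 2) (Icc 0 1) x := by
    have hx' : 1 - x ∈ Icc (0 : ℝ) 1 := ⟨by linarith [hx.2], by linarith [hx.1]⟩
    convert! ((hf x hx).fun_add (hasDerivWithinAt_comp_one_sub (hf (1 - x) hx'))).sub_const (w b)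
      using 1
    rw [hDs, hA]
    ring
  have hα' : ContinuousOn (fun x => -((D x * w x) ^ p * D x)) (Icc 0 b) :=
    (((hDc.continuousOn.mul (continuousOn_of_hasDerivWithinAt hw)).rpow_const
      fun _ _ => Or.inr (by linarith)).mul hDc.continuousOn).neg
  obtain ⟨K, hK⟩ := exists_lipschitzOnWith_of_continuousOn_deriv hα hα'
  have hφL : LipschitzOnWith K φ (Icc 0 1) := by
    refine LipschitzOnWith.of_dist_le_mul fun x hx y hy => ?_
    refine (hK.dist_le_mul _ ⟨le_min hx.1 hb0.le, min_le_right _ _⟩ _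
      ⟨le_min hy.1 hb0.le, min_le_right _ _⟩).trans ?_
    refine mul_le_mul_of_nonneg_left ?_ K.2
    rw [Real.dist_eq, Real.dist_eq]
    exact (abs_min_sub_min_le_max x b y b).trans (by simp)
  have hφL' : LipschitzOnWith K (fun x => φ (1 - x)) (Icc 0 1) := by
    refine LipschitzOnWith.of_dist_le_mul fun x hx y hy => ?_
    have := hφL.dist_le_mul (1 - x) ⟨by linarith [hx.2], by linarith [hx.1]⟩ (1 - y)
      ⟨by linarith [hy.2], by linarith [hy.1]⟩
    rwa [dist_sub_left] at this
  have hAac : AbsolutelyContinuousOnInterval A 0 1 := by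
    rw [← uIcc_of_le zero_le_one] at hφL hφL'
    exact hφL.absolutelyContinuousOnInterval.sub hφL'.absolutelyContinuousOnInterval
  have hAc : ContinuousOn A (Icc 0 1) := by
    have := hAac.continuousOn
    rwa [uIcc_of_le zero_le_one] at this
  have hWac : AbsolutelyContinuousOnInterval W 0 1 :=
    absolutelyContinuousOnInterval_of_continuousOn_deriv zero_le_one hW
      (hAc.div (hDc.continuousOn.pow 2) fun x hx => pow_ne_zero 2 (hDne x hx))
  have hDac' : AbsolutelyContinuousOnInterval D' 0 1 :=
    absolutelyContinuousOnInterval_of_continuousOn_deriv zero_le_one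
      (fun x _ => (hD' x).hasDerivWithinAt) (hDc.continuousOn.const_mul lam).fun_neg
  have hDinv : AbsolutelyContinuousOnInterval (fun x => (D x)⁻¹) 0 1 := by
    have hDc' : Continuous D' := continuous_iff_continuousAt.2 fun x => (hD' x).continuousAt
    exact absolutelyContinuousOnInterval_of_continuousOn_deriv zero_le_one
      (fun x hx => (hD x).hasDerivWithinAt.fun_inv (hDne x hx))
      (hDc'.continuousOn.neg.div (hDc.continuousOn.pow 2) fun x hx => pow_ne_zero 2 (hDne x hx))
  have hφl (x : ℝ) (hx : x ∈ Ioo 0 b) : HasDerivAt φ (-((D x * w x) ^ p * D x)) x :=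
    (hasDerivWithinAt_comp_min_of_lt hα hx.1.le hx.2).hasDerivAt
      (Icc_mem_nhds hx.1 (by linarith [hx.2]))
  have hφr (x : ℝ) (hx : b < x) : HasDerivAt φ 0 x := hasDerivAt_comp_min_of_gt hx
  have hφrefl {c x : ℝ} (hc : HasDerivAt φ c (1 - x)) : HasDerivAt (fun x => φ (1 - x)) (-c) x := by
    simpa using hc.comp_const_sub 1 x
  have hA' (x : ℝ) (hx : x ∈ Ioo (0 : ℝ) 1) (hxb : x ≠ b) (hxb' : x ≠ 1 - b) :
      HasDerivAt A (-(weight h x * (D x * W x) ^ p * D x)) x := by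
    rcases lt_or_gt_of_ne hxb with hlt | hgt
    · rw [weight_eq_one (Or.inl hlt.le), Wl x hlt.le]
      convert! (hφl x ⟨hx.1, hlt⟩).fun_sub (hφrefl (hφr (1 - x) (by linarith))) using 1
      ring
    rcases lt_or_gt_of_ne hxb' with hlt' | hgt'
    · rw [weight_eq_zero ⟨hgt, by rwa [hbm]⟩]
      convert! (hφr x hgt).fun_sub (hφrefl (hφr (1 - x) (by linarith))) using 1
      ring
    · rw [weight_eq_one (Or.inr (by rw [hbm]; exact hgt'.le)), Wr x hgt.le,
        min_eq_left (by linarith)]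
      convert! (hφr x hgt).fun_sub
        (hφrefl (hφl (1 - x) ⟨by linarith [hx.2], by linarith⟩)) using 1
      rw [hDs]
      ring
  have hnear : ∀ x ∈ Ioo (0 : ℝ) 1, Icc (0 : ℝ) 1 ∈ nhds x := fun x hx => Icc_mem_nhds hx.1 hx.2
  have hWb : w (min 1 b) = w b := by rw [min_eq_right (by linarith)]
  -- The derivative `D' W + A / D` is built by sums and products from absolutely continuous factors;
  -- the equation may fail only at the jumps `b` and `1 - b`.
  refine ⟨fun x => D x * W x, ⟨⟨⟨fun x => D' x * W x + A x * (D x)⁻¹, fun x hx => ?_, ?_, ?_⟩,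
    ?_, ?_⟩, fun x hx => mul_nonneg (hDpos x hx).le (Wnn x hx), ?_⟩, fun x _ => ?_⟩
  · convert! (hD x).hasDerivWithinAt.fun_mul (hW x hx) using 1
    have := hDne x hx
    field_simp
  · exact (hDac'.fun_mul hWac).fun_add (hAac.fun_mul hDinv)
  · rw [ae_restrict_iff' measurableSet_Ioo]
    have hne (c : ℝ) : ∀ᵐ t : ℝ, t ≠ c := by simp [ae_iff]
    filter_upwards [hne b, hne (1 - b)] with x hxb hxb' hx
    have hxm := Ioo_subset_Icc_self hx
    convert! ((hD' x).fun_mul ((hW x hxm).hasDerivAt (hnear x hx))).fun_add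
      ((hA' x hx hxb hxb').fun_mul ((hD x).fun_inv (hDne x hxm))) using 1
    have := hDne x hxm
    field_simp
    ring
  · simp only [Wl 0 hb0.le, w0, mul_zero]
  · simp only [Wr 1 (by linarith), sub_self, min_eq_left hb0.le, w0, mul_zero]
  · by_contra! hz
    have hw0 : ∀ x ∈ Icc 0 b, w x = 0 := fun x hx => by
      have hxm : x ∈ Icc (0 : ℝ) 1 := ⟨hx.1, by linarith [hx.2]⟩
      rw [← Wl x hx.2]
      exact (mul_eq_zero.1 (hz x hxm)).resolve_left (hDne x hxm)
    have := deriv_eq_zero_of_eqOn_const hb0 hw hw0 ⟨le_rfl, hb0.le⟩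
    have hD0 := hDpos 0 ⟨le_rfl, zero_le_one⟩
    have : 0 < α 0 / D 0 ^ 2 := by positivity
    linarith
  · simp only [hDs, Wsymm]

lemma exists_symmetric_positive {p h lam : ℝ} (hp : 1 < p) (hh : h ∈ Ioo (0 : ℝ) 1)
    (hlam : lam < Real.pi ^ 2) :
    ∃ u, IsPositiveSolution (weight h) p lam u ∧ IsSymmetric u := by
  obtain ⟨D, D', hD, hD', hDs, -, hDpos⟩ := exists_linear_profile hlam
  have hb0 : 0 < (1 - h) / 2 := by linarith [hh.2]
  obtain ⟨w, α, w0, α0, αb, wnn, hw, hα⟩ := exists_shooting hp hb0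
    (fun x _ => (hD x).continuousAt.continuousWithinAt)
    (fun x hx => hDpos x ⟨hx.1, by linarith [hx.2, hh.1]⟩)
  exact exists_symmetric_of_shooting hp hh hD hD' hDs hDpos w0 α0 αb wnn hw hα

end MooreNehari

/-- Functions on `[0,1]` are represented by functions on `ℝ`, compared on `[0,1]` only. -/
theorem theorem2p1 (p : ℝ) (hp : 1 < p) (h : ℝ) (hh : h ∈ Set.Ioo (0 : ℝ) 1) :
    (∀ lam : ℝ, lam < Real.pi ^ 2 →
      ∃ u : ℝ → ℝ,
        (MooreNehari.IsPositiveSolution (MooreNehari.weight h) p lam u ∧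
          MooreNehari.IsSymmetric u) ∧
        ∀ w : ℝ → ℝ,
          MooreNehari.IsPositiveSolution (MooreNehari.weight h) p lam w →
          MooreNehari.IsSymmetric w →
          Set.EqOn w u (Set.Icc 0 1)) ∧
    (∀ lam : ℝ,
      (∃ u : ℝ → ℝ, MooreNehari.IsPositiveSolution (MooreNehari.weight h) p lam u) ↔
        lam < Real.pi ^ 2) := by
  refine ⟨fun lam hlam => ?_, fun lam => ⟨?_, fun hlam => ?_⟩⟩
  · obtain ⟨u, hu, hsymm⟩ := MooreNehari.exists_symmetric_positive hp hh hlam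
    exact ⟨u, ⟨hu, hsymm⟩, fun w hw hwsymm => hw.eqOn_of_isSymmetric hp hh hwsymm hu hsymm⟩
  · rintro ⟨u, hu⟩
    exact hu.lt_pi_sq (by linarith) hh
  · obtain ⟨u, hu, -⟩ := MooreNehari.exists_symmetric_positive hp hh hlam
    exact ⟨u, hu⟩
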